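/- **Count-Through Theorem.** Write $\mathbb{R}=2^\omega$ for Cantor space and call its elements reals. Fix the canonical pairing bijection $\langle\cdot,\cdot\rangle:\omega\times\omega\to\omega$ given by $\langle n,k\rangle=k^2+n$ if $n<k$ and $\langle n,k\rangle=n^2+n+k$ otherwise. A real $x$ codes the relation $\triangleleft_x$ on $\omega$ given by $n\triangleleft_x k\iff x(\langle n,k\rangle)=1$; its field is the set of all $n$ with $n\triangleleft_x k$ or $k\triangleleft_x n$ for some $k$. Let $WO$ be the set of reals $x$ such that $\triangleleft_x$ is a (reflexive) well-order of its field, i.e. a linear order of the field in which every nonempty subset of the field has a least element (the empty relation included). An infinite time Turing machine has an input, a scratch and an output tape, each with cells indexed by $\omega$ and containing $0$ or $1$, and one head which overlies the cells of the same index on the three tapes. A program is a finite table which, for each of finitely many states (among them the distinct states *start*, *limit* and *halt*) and each triple of digits under the head, gives the digits to write, a move left or right (a left move from the first cell leaves the head there) and the next state. At stage $0$ the machine is in the *start* state with its head on the first cell, the input $x\in\mathbb{R}$ on the input tape and zeros on the other tapes; stage $\alpha+1$ is obtained from stage $\alpha$ by one application of the table; at a limit ordinal stage the state is *limit*, the head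 is on the first cell, and each cell contains the $\limsup$ of its contents at the earlier stages. The computation halts at the first ordinal stage at which the state is *halt*, and its output is then the content of the output tape. A set $A\subseteq\mathbb{R}$ is infinite time decidable if there is a program which, on every input $x\in\mathbb{R}$, halts, with output $\langle 1,0,0,\ldots\rangle$ if $x\in A$ and output $\langle 0,0,0,\ldots\rangle$ if $x\notin A$. Then $WO$ is infinite time decidable. -/

import Mathlib

/-- The reals: infinite binary sequences, i.e. elements of Cantor space `2^ω`
(`true` is the digit `1`, `false` the digit `0`). -/
abbrev CantorReal : Type := ℕ → Bool

/-- The real `⟨0, 0, 0, …⟩`. -/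
def CantorReal.zero : CantorReal := fun _ => false

/-- The real `⟨1, 0, 0, …⟩`. -/
def CantorReal.one : CantorReal := fun n => decide (n = 0)

namespace ITTM

/-- The three tapes of an infinite time Turing machine. -/
inductive Tape : Type
  | input
  | scratch
  | output

/-- The two possible head movements. -/
inductive Move : Type
  | left
  | right

/-- The states of a program: the three distinguished states and finitely many others. -/
inductive State (n : ℕ) : Type
  | start
  | limit
  | halt
  | work (i : Fin n)

/-- A program: a finite table which, from the current state and the three digits under the head,
gives the new state, the three digits to be written there, and the head movement.
(The row for the state `halt` is never used.) -/
structure Program : Type where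
  numStates : ℕ
  table : State numStates → (Tape → Bool) → State numStates × (Tape → Bool) × Move

/-- A configuration: the state, the position of the (single) head and the contents of the tapes,
which are infinite to the right. -/
structure Config (n : ℕ) : Type where
  state : State n
  head : ℕ
  cells : Tape → ℕ → Bool

namespace Program

/-- The starting configuration on input `x`. -/
def init (p : Program) (x : CantorReal) : Config p.numStates where
  state := State.start
  head := 0
  cells
    | Tape.input => x
    | Tape.scratch => fun _ => false
    | Tape.output => fun _ => false

/-- One step of computation. A head told to move left from the first cell stays there. -/
def step (p : Program) (c : Config p.numStates) : Config p.numStates :=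
  let r := p.table c.state (fun t => c.cells t c.head)
  { state := r.1
    head :=
      match r.2.2 with
      | Move.left => c.head - 1
      | Move.right => c.head + 1
    cells := fun t => Function.update (c.cells t) c.head (r.2.1 t) }

open Classical in
/-- The configuration at a limit stage `l`, given those at all earlier stages: limit state, head on
the first cell, and a cell is `0` if its earlier values are eventually `0`; otherwise (eventually
`1`, or alternating unboundedly often) it is `1`. -/
noncomputable def limitConfig (p : Program) (l : Ordinal.{0})
    (c : ∀ a : Ordinal.{0}, a < l → Config p.numStates) : Config p.numStates where
  state := State.limit
  head := 0
  cells := fun t n =>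
    decide (¬ ∃ b, b < l ∧ ∀ a, ∀ h : a < l, b ≤ a → (c a h).cells t n = false)

/-- The configuration of the program `p` on input `x` at each ordinal stage. (What the recursion
gives after the first stage in the state `halt` is never used.) -/
noncomputable def run (p : Program) (x : CantorReal) (a : Ordinal.{0}) : Config p.numStates :=
  Ordinal.limitRecOn a (p.init x) (fun _ c => p.step c) (fun l _ c => p.limitConfig l c)

theorem run_zero (p : Program) (x : CantorReal) : p.run x 0 = p.init x := by
  simp [run]

theorem run_succ (p : Program) (x : CantorReal) (a : Ordinal.{0}) :
    p.run x (Order.succ a) = p.step (p.run x a) := by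
  simp [run]

theorem run_limit (p : Program) (x : CantorReal) (l : Ordinal.{0}) (hl : Order.IsSuccLimit l) :
    p.run x l = p.limitConfig l (fun a _ => p.run x a) := by
  simp [run, Ordinal.limitRecOn_limit, hl]

/-- The stages at which the machine finds itself in the halt state; the computation ceases at the
first of them. -/
def haltStages (p : Program) (x : CantorReal) : Set Ordinal.{0} :=
  {a | (p.run x a).state = State.halt}

/-- The partial function `φ_p` computed by `p`: it is defined at `x` if the computation on input
`x` halts, and its value is then what is written on the output tape at the halting stage. -/
noncomputable def eval (p : Program) : CantorReal →. CantorReal := fun x =>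
  { Dom := (p.haltStages x).Nonempty
    get := fun _ => (p.run x (sInf (p.haltStages x))).cells Tape.output }

end Program

/-- A partial function on the reals is infinite time computable if it is `φ_p` for a program `p`. -/
def IsComputable (f : CantorReal →. CantorReal) : Prop :=
  ∃ p : Program, p.eval = f

open Classical in
/-- A set of reals is infinite time decidable if its characteristic function is infinite time
computable. -/
def IsDecidable (A : Set CantorReal) : Prop :=
  IsComputable (PFun.lift fun x => if x ∈ A then CantorReal.one else CantorReal.zero)

end ITTM

/-- The relation coded by the real `x`. -/
def codedRel (x : CantorReal) (n k : ℕ) : Prop :=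
  x (Nat.pair n k) = true

/-- The field of the relation coded by `x`. -/
def codedField (x : CantorReal) : Set ℕ :=
  {n | ∃ k, codedRel x n k ∨ codedRel x k n}

/-- The real `x` codes a well-order, in the reflexive sense, of the field of the relation it
codes: a linear order in which every nonempty subset has a least element. -/
structure CodesWellOrder (x : CantorReal) : Prop where
  refl : ∀ n ∈ codedField x, codedRel x n n
  antisymm : ∀ n k, codedRel x n k → codedRel x k n → n = k
  trans : ∀ n k r, codedRel x n k → codedRel x k r → codedRel x n r
  total : ∀ n ∈ codedField x, ∀ k ∈ codedField x, codedRel x n k ∨ codedRel x k n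
  least : ∀ S : Set ℕ, S ⊆ codedField x → S.Nonempty → ∃ n ∈ S, ∀ k ∈ S, codedRel x n k

/-- The set of reals coding well-orders (of subsets of `ω`). -/
def WO : Set CantorReal := {x | CodesWellOrder x}

/-!
An infinite time Turing machine decides `WO` by deleting numbers one after another. Write `F` for
the set of all `n` with `n ◁ n`, which is the field if `◁` is reflexive. A number `c` that has not
been deleted yet is a *good candidate* if `◁` relates it to members of `F` only, and to none unless
`c ∈ F`, and if moreover, in case `c ∈ F`, it is the strictly least remaining member of `F`
(`good_iff`). Deleting good candidates preserves a property `Sound` of the set of deleted numbers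
that implies, once everything has been deleted, that `◁` is a well-order of its field
(`codesWellOrder_of_sound`). Conversely a well-order always has a good candidate as long as anything
is left (`exists_good`). Hence `x ∈ WO` if and only if nothing is left when the supply of good
candidates ends, and it does end because an injection of the ordinals into `ℕ` would result otherwise
(`exists_finalAt`).

The machine tries the candidates `0, 1, 2, …` in turn. For a candidate it goes through all pairs and
passes to the next candidate as soon as a pair speaks against it. Thus a single search for a good
candidate takes just `ω` stages (`search`): either some candidate survives for ever and can be read
off at the limit, or the candidate changes again and again. A flag that is set at each change and
cleared whenever a pair does not speak against the candidate shows at the limit which of the two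
happened. A second flag, set during each deletion, is found set at a limit of limit stages and only
there (and after the first `ω` stages, which serve to write down `F`). The limit state then simply
starts a new search; the tape with the deleted numbers needs no care, since they increase and the
limit forms their union.

A natural number is kept in unary, as the first mark on a track. Marks beyond the first one are
ignored, so that the garbage left by a limit does no harm. Since more than three tracks are needed,
the machine is a *block machine*, which reads and writes whole blocks of cells; `path_step` shows
that an ordinary program simulates it. All finite pieces of the computation are described by
`Program.Path`, which also says that each cell shows at every moment its content at the beginning
or its content at the end; this is why the contents of the cells at the next limit are known from
the ends of the paths (`Program.run_of_paths`).
-/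

open Filter

/-! ### Paths, and the limit of a sequence of paths -/

namespace ITTM

namespace Program

/-- `p.Path c c'` says that `p` gets from `c` to `c'` in finitely many steps, at least one, without
halting before the end, and that every cell shows at each moment in between either its content in
`c` or its content in `c'`. The last clause makes the values at the ends of consecutive paths
suffice to compute the cells at the next limit stage. -/
def Path (p : Program) (c c' : Config p.numStates) : Prop :=
  ∃ k, 0 < k ∧ p.step^[k] c = c' ∧ ∀ i < k, (p.step^[i] c).state ≠ State.halt ∧
    ∀ t n, (p.step^[i] c).cells t n = c.cells t n ∨ (p.step^[i] c).cells t n = c'.cells t n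

theorem Path.trans {p : Program} {c d e : Config p.numStates} (h₁ : p.Path c d) (h₂ : p.Path d e)
    (hd : ∀ t n, d.cells t n = c.cells t n ∨ d.cells t n = e.cells t n) : p.Path c e := by
  obtain ⟨k, hk, rfl, h₁⟩ := h₁
  obtain ⟨l, hl, rfl, h₂⟩ := h₂
  refine ⟨l + k, by omega, by rw [Function.iterate_add_apply], fun i hi => ?_⟩
  rcases lt_or_ge i k with hik | hik
  · refine ⟨(h₁ i hik).1, fun t n => ?_⟩
    rcases (h₁ i hik).2 t n with h | h
    · exact Or.inl h
    · rw [h]; exact hd t n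
  · obtain ⟨j, rfl⟩ := Nat.exists_eq_add_of_le' hik
    rw [Function.iterate_add_apply]
    refine ⟨(h₂ j (by omega)).1, fun t n => ?_⟩
    rcases (h₂ j (by omega)).2 t n with h | h
    · rw [h]; exact hd t n
    · exact Or.inr h

theorem run_add_nat (p : Program) (x : CantorReal) (a : Ordinal.{0}) (k : ℕ) :
    p.run x (a + k) = p.step^[k] (p.run x a) := by
  induction k with
  | zero => simp
  | succ k ih =>
    rw [Function.iterate_succ_apply', ← ih, ← run_succ]
    congr 1
    push_cast
    rw [← add_assoc, ← Order.succ_eq_add_one]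

theorem isSuccLimit_add_omega (a : Ordinal.{0}) : Order.IsSuccLimit (a + Ordinal.omega0) :=
  Ordinal.isSuccLimit_add a Ordinal.isSuccLimit_omega0

theorem exists_nat_of_lt_add_omega {a b : Ordinal.{0}} (h : a ≤ b)
    (hb : b < a + Ordinal.omega0) : ∃ m : ℕ, b = a + m := by
  obtain ⟨d, rfl⟩ := exists_add_of_le h
  obtain ⟨m, rfl⟩ := Ordinal.lt_omega0.1 ((add_lt_add_iff_left a).1 hb)
  exact ⟨m, rfl⟩

/-- The stages `a ≤ b ≤ a + ω` of a computation that from stage `a` on follows an infinite sequence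
of paths. -/
theorem run_of_paths {p : Program} {x : CantorReal} {a : Ordinal.{0}}
    {C : ℕ → Config p.numStates} (h₀ : p.run x a = C 0) (hC : ∀ i, p.Path (C i) (C (i + 1))) :
    (∀ b, a ≤ b → b < a + Ordinal.omega0 → (p.run x b).state ≠ State.halt ∧
      ∃ i, ∀ t n, (p.run x b).cells t n = (C i).cells t n ∨
        (p.run x b).cells t n = (C (i + 1)).cells t n) ∧
    (∀ i, ∃ b, a ≤ b ∧ b < a + Ordinal.omega0 ∧ p.run x b = C i) ∧
    (p.run x (a + Ordinal.omega0)).state = State.limit ∧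
    (p.run x (a + Ordinal.omega0)).head = 0 ∧
    ∀ t n, (p.run x (a + Ordinal.omega0)).cells t n = true ↔
      ∃ᶠ i in atTop, (C i).cells t n = true := by
  choose k hk hk' hbet using hC
  -- `T i` is the number of steps after which `C i` is reached
  let T : ℕ → ℕ := fun i => ∑ j ∈ Finset.range i, k j
  have hT : ∀ i, T (i + 1) = T i + k i := fun i => Finset.sum_range_succ _ _
  have hTmono : StrictMono T := strictMono_nat_of_lt_succ fun i => by have := hk i; rw [hT]; omega
  have hrun : ∀ i, p.run x (a + (T i : ℕ)) = C i := by
    intro i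
    induction i with
    | zero => simpa [T] using h₀
    | succ i ih => rw [hT, run_add_nat, Nat.add_comm, Function.iterate_add_apply, ← run_add_nat, ih, hk']
  have hfind : ∀ m, ∃ i j, j < k i ∧ m = T i + j := by
    intro m
    induction m with
    | zero => exact ⟨0, 0, hk 0, by simp [T]⟩
    | succ m ih =>
      obtain ⟨i, j, hj, rfl⟩ := ih
      rcases Nat.lt_or_ge (j + 1) (k i) with h | h
      · exact ⟨i, j + 1, h, by omega⟩
      · exact ⟨i + 1, 0, hk _, by rw [hT]; omega⟩
  have hlt : ∀ m : ℕ, a + (m : Ordinal) < a + Ordinal.omega0 := fun m =>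
    (add_lt_add_iff_left a).2 (Ordinal.natCast_lt_omega0 m)
  have hst : ∀ i j, j < k i → p.run x (a + ((T i + j : ℕ) : Ordinal)) = p.step^[j] (C i) := by
    intro i j _
    rw [run_add_nat, Nat.add_comm, Function.iterate_add_apply, ← run_add_nat, hrun]
  refine ⟨fun b hab hb => ?_, fun i => ⟨_, le_self_add, hlt (T i), hrun i⟩, ?_, ?_, fun t n => ?_⟩
  · obtain ⟨m, rfl⟩ := exists_nat_of_lt_add_omega hab hb
    obtain ⟨i, j, hj, rfl⟩ := hfind m
    rw [hst i j hj]
    exact ⟨(hbet i j hj).1, i, (hbet i j hj).2⟩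
  · rw [run_limit _ _ _ (isSuccLimit_add_omega a)]; rfl
  · rw [run_limit _ _ _ (isSuccLimit_add_omega a)]; rfl
  · rw [run_limit _ _ _ (isSuccLimit_add_omega a)]
    simp only [limitConfig, decide_eq_true_eq]
    rw [frequently_atTop]
    constructor
    · intro h N
      by_contra hcon
      push Not at hcon
      refine h ⟨a + (T N : ℕ), hlt _, fun b hb hab => ?_⟩
      obtain ⟨m, rfl⟩ := exists_nat_of_lt_add_omega (le_trans le_self_add hab) hb
      obtain ⟨i, j, hj, rfl⟩ := hfind m
      have hm : T N ≤ T i + j := by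
        have := (add_le_add_iff_left a).1 hab
        exact_mod_cast this
      have hNi : N ≤ i := by
        by_contra hlt'
        have := hTmono.monotone (show i + 1 ≤ N by omega)
        rw [hT] at this
        omega
      rw [hst i j hj]
      rcases (hbet i j hj).2 t n with h' | h' <;> rw [h']
      · simpa using hcon i hNi
      · simpa using hcon (i + 1) (by omega)
    · rintro h ⟨b, hb, hfalse⟩
      obtain ⟨N, hN⟩ : ∃ N : ℕ, b ≤ a + N := by
        rcases le_total b a with hba | hab
        · exact ⟨0, by simpa using hba⟩
        · obtain ⟨m, rfl⟩ := exists_nat_of_lt_add_omega hab hb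
          exact ⟨m, le_rfl⟩
      obtain ⟨i, hi, htrue⟩ := h N
      have := hfalse (a + (T i : ℕ)) (hlt _) (hN.trans ((add_le_add_iff_left a).2 (by
        exact_mod_cast hi.trans hTmono.le_apply)))
      rw [hrun] at this
      rw [this] at htrue
      cases htrue

end Program

end ITTM

/-! ### Block machines -/

namespace ITTM

/-- The contents of a block of consecutive cells of the three tapes, the cells of the block being
named by the elements of `K`. -/
abbrev Block (K : Type) : Type := Tape → K → Bool

/-- The states of a block machine: the distinguished ones and those of `Q`. -/
inductive Ctrl (Q : Type) : Type
  | start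
  | limit
  | halt
  | work (q : Q)

/-- An infinite time Turing machine whose head reads and writes whole blocks of cells and moves from
block to block. -/
structure BlockMachine (Q K : Type) : Type where
  table : Ctrl Q → Block K → Ctrl Q × Block K × Move

/-- A configuration of a block machine; `rows j` is the content of the `j`-th block. -/
structure BlockConfig (Q K : Type) : Type where
  state : Ctrl Q
  head : ℕ
  rows : ℕ → Block K

/-- The states of the program that simulates a block machine with `B` cells in a block: those in
which it collects the digits of a block, those in which it writes a block from the last cell to the
first, and those in which it moves on to a neighbouring block. The number is that of the cell of the
block, or of the remaining moves. -/
inductive Micro (Q K : Type) (B : ℕ) : Type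
  | read (q : Ctrl Q) (r : Fin B) (acc : Block K)
  | write (q : Ctrl Q) (b : Block K) (m : Move) (r : Fin B)
  | shift (q : Ctrl Q) (m : Move) (r : Fin B)

instance : Finite Tape :=
  Finite.of_injective
    (fun t : Tape => match t with | .input => (0 : Fin 3) | .scratch => 1 | .output => 2)
    (by rintro ⟨⟩ ⟨⟩ h <;> first | rfl | simp at h)

instance : Finite Move :=
  Finite.of_injective (fun m : Move => match m with | .left => false | .right => true)
    (by rintro ⟨⟩ ⟨⟩ h <;> first | rfl | simp at h)

instance {Q : Type} [Finite Q] : Finite (Ctrl Q) :=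
  Finite.of_injective
    (fun s : Ctrl Q => match s with
      | .start => (Sum.inl 0 : Fin 3 ⊕ Q) | .limit => Sum.inl 1 | .halt => Sum.inl 2
      | .work q => Sum.inr q)
    (by rintro (_ | _ | _ | q) (_ | _ | _ | q') h <;> simp_all)

instance {Q K : Type} {B : ℕ} [Finite Q] [Finite K] : Finite (Micro Q K B) :=
  Finite.of_injective
    (fun s : Micro Q K B => match s with
      | .read q r acc => (Sum.inl (q, r, acc) :
          (Ctrl Q × Fin B × Block K) ⊕ ((Ctrl Q × Block K × Move × Fin B) ⊕ (Ctrl Q × Move × Fin B)))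
      | .write q b m r => Sum.inr (Sum.inl (q, b, m, r))
      | .shift q m r => Sum.inr (Sum.inr (q, m, r)))
    (by rintro (_ | _ | _) (_ | _ | _) h <;> simp_all)

/-- The move of the head, as a function on positions. -/
def Move.act : Move → ℕ → ℕ
  | .left, n => n - 1
  | .right, n => n + 1

theorem Program.step_eq (p : Program) (c : Config p.numStates) {s : State p.numStates}
    {d : Tape → Bool} {m : Move} (h : p.table c.state (fun t => c.cells t c.head) = (s, d, m)) :
    p.step c = ⟨s, m.act c.head, fun t => Function.update (c.cells t) c.head (d t)⟩ := by
  unfold Program.step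
  rw [h]
  cases m <;> rfl

namespace BlockMachine

variable {Q K : Type}

/-- One step of a block machine. -/
def step (M : BlockMachine Q K) (C : BlockConfig Q K) : BlockConfig Q K :=
  let r := M.table C.state (C.rows C.head)
  ⟨r.1, r.2.2.act C.head, Function.update C.rows C.head r.2.1⟩

variable {B : ℕ} [NeZero B] (e : K ≃ Fin B)

/-- The number `r`, for `r < B`, as an element of `Fin B`. -/
def num (r : ℕ) : Fin B := Fin.ofNat B r

theorem val_num {r : ℕ} (h : r < B) : (num r : Fin B).val = r := Nat.mod_eq_of_lt h

theorem num_val (r : Fin B) : num r.val = r := Fin.ext (val_num r.2)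

/-- The table of the simulating program. With the last digit collected the content of the block is
known, so that the last cell can be rewritten at once. The move made when the first cell is
rewritten is the first one of the `B` moves to the neighbouring block. The functions `f` and `w`
code the states. -/
def microTable (M : BlockMachine Q K) {S : Type} (f : Ctrl Q → S) (w : Micro Q K B → S) :
    Micro Q K B → (Tape → Bool) → S × (Tape → Bool) × Move
  | .read q r acc, d =>
    let acc' : Block K := fun t k => if e k = r then d t else acc t k
    let y := M.table q acc'
    if r.val + 1 < B then (w (.read q (num (r + 1)) acc'), d, .right)
    else (w (.write y.1 y.2.1 y.2.2 (num (B - 2))), fun t => y.2.1 t (e.symm r), .left)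
  | .write q b m r, _ =>
    if r.val = 0 then (w (.shift q m (num (B - 2))), fun t => b t (e.symm r), m)
    else (w (.write q b m (num (r - 1))), fun t => b t (e.symm r), .left)
  | .shift q m r, d =>
    if r.val = 0 then (f q, d, m) else (w (.shift q m (num (r - 1))), d, m)

variable [Finite Q] [Finite K]

/-- The state of the simulating program with a given code. -/
noncomputable def workState (s : Micro Q K B) : State (Nat.card (Micro Q K B)) :=
  .work (Finite.equivFin _ s)

/-- The state in which the simulating program begins the simulation of a step. -/
noncomputable def toState : Ctrl Q → State (Nat.card (Micro Q K B))
  | .start => .start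
  | .limit => .limit
  | .halt => .halt
  | .work q => workState (.read (.work q) 0 fun _ _ => false)

/-- The program simulating a block machine. -/
noncomputable abbrev toProgram (M : BlockMachine Q K) : Program where
  numStates := Nat.card (Micro Q K B)
  table s d :=
    match s with
    | .start => M.microTable e toState workState (.read .start 0 fun _ _ => false) d
    | .limit => M.microTable e toState workState (.read .limit 0 fun _ _ => false) d
    | .halt => (.halt, d, .left)
    | .work i => M.microTable e toState workState ((Finite.equivFin _).symm i) d

theorem table_workState (M : BlockMachine Q K) (s : Micro Q K B) (d : Tape → Bool) :
    (M.toProgram e).table (workState s) d = M.microTable e toState workState s d := by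
  simp [toProgram, workState]

theorem table_toState (M : BlockMachine Q K) {q : Ctrl Q} (hq : q ≠ .halt) (d : Tape → Bool) :
    (M.toProgram e).table (toState q) d =
      M.microTable e toState workState (.read q 0 fun _ _ => false) d := by
  cases q with
  | halt => exact absurd rfl hq
  | work q => exact table_workState e M _ d
  | _ => rfl

omit [NeZero B] in
theorem workState_ne_halt (s : Micro Q K B) : workState s ≠ State.halt := by
  simp [workState]

theorem toState_ne_halt {q : Ctrl Q} (hq : q ≠ .halt) :
    (toState q : State (Nat.card (Micro Q K B))) ≠ State.halt := by
  cases q with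
  | halt => exact absurd rfl hq
  | work q => exact workState_ne_halt _
  | _ => simp [toState]

/-- The tapes with given blocks. -/
def flatten (R : ℕ → Block K) (t : Tape) (n : ℕ) : Bool :=
  R (n / B) t (e.symm (num n))

/-- The configuration of the simulating program that represents a configuration of a block
machine. -/
noncomputable def toConfig (M : BlockMachine Q K) (C : BlockConfig Q K) :
    Config (M.toProgram e).numStates :=
  ⟨toState C.state, C.head * B, flatten e C.rows⟩

omit [Finite K] in
theorem flatten_add (R : ℕ → Block K) (t : Tape) (j : ℕ) {r : ℕ} (hr : r < B) :
    flatten e R t (j * B + r) = R j t (e.symm (num r)) := by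
  have h₁ : (j * B + r) / B = j := by
    rw [Nat.add_comm, Nat.add_mul_div_right _ _ (by omega), Nat.div_eq_of_lt hr, Nat.zero_add]
  have h₂ : (num (j * B + r) : Fin B) = num r := by
    ext; simp [num, Fin.ofNat]
  rw [flatten, h₁, h₂]

omit [Finite K] in
theorem flatten_row (R : ℕ → Block K) (t : Tape) (j : ℕ) (k : K) :
    flatten e R t (j * B + e k) = R j t k := by
  rw [flatten_add e R t j (e k).2, num_val, Equiv.symm_apply_apply]

omit [Finite K] [NeZero B] in
theorem row_add_div (j : ℕ) (r : Fin B) : (j * B + r) / B = j := by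
  rw [Nat.add_comm, Nat.add_mul_div_right _ _ r.pos, Nat.div_eq_of_lt r.2, Nat.zero_add]

omit [Finite K] in
theorem exists_row_eq (n : ℕ) : ∃ (j : ℕ) (k : K), n = j * B + e k :=
  ⟨n / B, e.symm (num n), by simp [num, Fin.ofNat, Nat.div_add_mod']⟩

/-- The rows while the `j`-th block is being rewritten: its cells from the `r`-th on are new. -/
def partRows (R : ℕ → Block K) (j : ℕ) (b : Block K) (r : ℕ) : ℕ → Block K :=
  Function.update R j fun t k => if (e k : ℕ) < r then R j t k else b t k

omit [Finite K] in
theorem update_flatten (R : ℕ → Block K) (j : ℕ) (b : Block K) (t : Tape) {r : ℕ} (hr : r < B) :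
    Function.update (flatten e (partRows e R j b (r + 1)) t) (j * B + r) (b t (e.symm (num r))) =
      flatten e (partRows e R j b r) t := by
  funext n
  obtain ⟨j', k, rfl⟩ := exists_row_eq e n
  rw [flatten_row]
  by_cases hj : j' = j
  · subst hj
    by_cases hk : (e k : ℕ) = r
    · have : e.symm (num r) = k := by rw [← hk, num_val, Equiv.symm_apply_apply]
      simp [partRows, hk, this]
    · rw [Function.update_of_ne (by omega), flatten_row]
      have : (e k : ℕ) < r + 1 ↔ (e k : ℕ) < r := by omega
      simp only [partRows, Function.update_self, this]
  · rw [Function.update_of_ne, flatten_row]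
    · simp [partRows, hj]
    · intro h
      apply hj
      have := congrArg (· / B) h
      simpa only [row_add_div, row_add_div j ⟨r, hr⟩] using this

/-- The block machine simulation: every step is a path of the program. -/
theorem path_step (M : BlockMachine Q K) (hB : 2 ≤ B) (C : BlockConfig Q K) (hC : C.state ≠ .halt) :
    (M.toProgram e).Path (M.toConfig e C) (M.toConfig e (M.step C)) := by
  obtain ⟨q, j, R⟩ := C
  set y := M.table q (R j)
  have hstep : M.step ⟨q, j, R⟩ = ⟨y.1, y.2.2.act j, Function.update R j y.2.1⟩ := rfl
  -- the state of the program when `r` digits of the block are known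
  let acc : ℕ → Block K := fun r t k => if (e k : ℕ) < r then R j t k else false
  let rs : ℕ → State (Nat.card (Micro Q K B)) := fun r =>
    if r = 0 then toState q else workState (.read q (num r) (acc r))
  have hrs : ∀ r, 0 < r → rs r = workState (.read q (num r) (acc r)) := fun r hr =>
    if_neg (by omega)
  have htable : ∀ r, r < B → ∀ d, (M.toProgram e).table (rs r) d =
      M.microTable e toState workState (.read q (num r) (acc r)) d := by
    intro r hr d
    rcases Nat.eq_zero_or_pos r with rfl | hr0
    · exact table_toState e M hC d
    · rw [hrs r hr0, table_workState]
  have hacc : ∀ r, r < B → (fun (t : Tape) (k : K) => if e k = num r then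
      R j t (e.symm (num r)) else acc r t k) = acc (r + 1) := by
    intro r hr
    funext t k
    by_cases hk : (e k : ℕ) = r
    · have : e k = num r := by rw [← hk, num_val]
      rw [if_pos this, ← this, Equiv.symm_apply_apply]
      exact (if_pos (by omega)).symm
    · have : e k ≠ num r := fun h => hk (by rw [h, val_num hr])
      have h' : (e k : ℕ) < r + 1 ↔ (e k : ℕ) < r := by omega
      simp only [acc, if_neg this, h']
  have hread : ∀ r, r < B → (M.toProgram e).step^[r] (M.toConfig e ⟨q, j, R⟩) =
      ⟨rs r, j * B + r, flatten e R⟩ := by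
    intro r
    induction r with
    | zero => intro _; rfl
    | succ r ih =>
      intro hr
      rw [Function.iterate_succ_apply', ih (by omega),
        Program.step_eq _ _ (s := rs (r + 1)) (d := fun t => flatten e R t (j * B + r)) (m := .right)]
      · simp [Move.act, Nat.add_assoc]
      · rw [htable r (by omega)]
        simp only [microTable, val_num (show r < B by omega), hr, if_true,
          flatten_add e R _ j (show r < B by omega)]
        rw [hacc r (by omega), hrs _ (by omega)]
  let ws : ℕ → State (Nat.card (Micro Q K B)) := fun r =>
    workState (.write y.1 y.2.1 y.2.2 (num r))
  have hfull : partRows e R j y.2.1 B = R := by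
    simp [partRows]
  have hwrite : ∀ i, i ≤ B - 2 → (M.toProgram e).step^[B + i] (M.toConfig e ⟨q, j, R⟩) =
      ⟨ws (B - 2 - i), j * B + (B - 2 - i), flatten e (partRows e R j y.2.1 (B - 1 - i))⟩ := by
    intro i
    induction i with
    | zero =>
      intro _
      rw [show B + 0 = B - 1 + 1 by omega, Function.iterate_succ_apply', hread _ (by omega),
        Program.step_eq _ _ (s := ws (B - 2)) (d := fun t => y.2.1 t (e.symm (num (B - 1))))
          (m := .left)]
      · simp only [Move.act, Nat.sub_zero, Config.mk.injEq, true_and]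
        refine ⟨by omega, ?_⟩
        funext t
        rw [← update_flatten e R j y.2.1 t (show B - 1 < B by omega), Nat.sub_add_cancel (by omega),
          hfull]
      · rw [htable _ (by omega)]
        simp only [microTable, val_num (show B - 1 < B by omega),
          flatten_add e R _ j (show B - 1 < B by omega)]
        rw [hacc _ (by omega)]
        have : acc (B - 1 + 1) = R j := by
          funext t k; exact if_pos (by omega)
        rw [this, if_neg (by omega)]
    | succ i ih =>
      intro hi
      obtain ⟨r, hr⟩ : ∃ r, B - 2 - i = r + 1 := ⟨B - 2 - i - 1, by omega⟩
      rw [← Nat.add_assoc, Function.iterate_succ_apply', ih (by omega), hr,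
        Program.step_eq _ _ (s := ws r) (d := fun t => y.2.1 t (e.symm (num (r + 1))))
          (m := .left)]
      · rw [show B - 2 - (i + 1) = r by omega, show B - 1 - i = r + 1 + 1 by omega,
          show B - 1 - (i + 1) = r + 1 by omega]
        simp only [Move.act, Config.mk.injEq, true_and]
        refine ⟨by omega, ?_⟩
        funext t
        exact update_flatten e R j y.2.1 t (by omega)
      · refine (table_workState e M _ _).trans ?_
        simp [microTable, val_num (show r + 1 < B by omega), ws]
  let ss : ℕ → State (Nat.card (Micro Q K B)) := fun r =>
    if r = 0 then toState y.1 else workState (.shift y.1 y.2.2 (num (r - 1)))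
  have hss : ∀ r, ss (r + 1) = workState (.shift y.1 y.2.2 (num r)) := fun r => rfl
  have hzero : partRows e R j y.2.1 0 = Function.update R j y.2.1 := by simp [partRows]
  have hshift : ∀ i, i ≤ B - 1 →
      (M.toProgram e).step^[B + (B - 2) + (1 + i)] (M.toConfig e ⟨q, j, R⟩) =
      ⟨ss (B - 1 - i), y.2.2.act^[i + 1] (j * B), flatten e (Function.update R j y.2.1)⟩ := by
    intro i
    induction i with
    | zero =>
      intro _
      rw [Nat.add_zero, Function.iterate_succ_apply', hwrite _ le_rfl,
        Program.step_eq _ _ (s := ss (B - 1)) (d := fun t => y.2.1 t (e.symm (num 0)))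
          (m := y.2.2)]
      · simp only [Nat.sub_self, Nat.add_zero, Nat.sub_zero, Function.iterate_one, Nat.zero_add,
          Config.mk.injEq, true_and]
        funext t
        rw [← hzero, show B - 1 - (B - 2) = 0 + 1 by omega]
        exact update_flatten e R j y.2.1 t (show 0 < B by omega)
      · rw [show B - 1 = B - 2 + 1 by omega, hss]
        refine (table_workState e M _ _).trans ?_
        simp [microTable, val_num (show 0 < B by omega)]
    | succ i ih =>
      intro hi
      obtain ⟨r, hr⟩ : ∃ r, B - 1 - i = r + 1 := ⟨B - 1 - i - 1, by omega⟩
      rw [← Nat.add_assoc 1, ← Nat.add_assoc _ _ 1, Function.iterate_succ_apply', ih (by omega), hr,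
        Program.step_eq _ _ (s := ss r) (m := y.2.2) (d := fun t =>
          flatten e (Function.update R j y.2.1) t (y.2.2.act^[i + 1] (j * B)))]
      · rw [show B - 1 - (i + 1) = r by omega]
        simp [Function.iterate_succ_apply' _ (i + 1)]
      · rw [hss]
        refine (table_workState e M _ _).trans ?_
        rcases r with _ | r
        · simp [microTable, val_num (show 0 < B by omega), ss]
        · simp [microTable, val_num (show r + 1 < B by omega), ss]
  have hact : y.2.2.act^[B] (j * B) = y.2.2.act j * B := by
    cases y.2.2 with
    | left =>
      have : ∀ i n, Move.left.act^[i] n = n - i := by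
        intro i n
        induction i with
        | zero => rfl
        | succ i ih => rw [Function.iterate_succ_apply', ih]; simp [Move.act]; omega
      rw [this]
      simp [Move.act, Nat.sub_mul]
    | right =>
      have : ∀ i n, Move.right.act^[i] n = n + i := by
        intro i n
        induction i with
        | zero => rfl
        | succ i ih => rw [Function.iterate_succ_apply', ih]; simp [Move.act]; omega
      rw [this]
      simp [Move.act, Nat.add_mul]
  have hpart : ∀ r t n, flatten e (partRows e R j y.2.1 r) t n = flatten e R t n ∨
      flatten e (partRows e R j y.2.1 r) t n = flatten e (Function.update R j y.2.1) t n := by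
    intro r t n
    obtain ⟨j', k, rfl⟩ := exists_row_eq e n
    simp only [flatten_row, partRows]
    by_cases hj : j' = j
    · subst hj
      by_cases hk : (e k : ℕ) < r <;> simp [hk]
    · simp [hj]
  refine ⟨B + (B - 2) + (1 + (B - 1)), by omega, ?_, fun i hi => ?_⟩
  · rw [hshift _ le_rfl, hstep, show B - 1 + 1 = B by omega, hact, Nat.sub_self]
    rfl
  · rw [hstep]
    change _ ∧ ∀ t n, _ = flatten e R t n ∨ _ = flatten e (Function.update R j y.2.1) t n
    rcases Nat.lt_or_ge i B with h1 | h1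
    · rw [hread i h1]
      refine ⟨?_, fun t n => Or.inl rfl⟩
      rcases Nat.eq_zero_or_pos i with rfl | h2
      · exact toState_ne_halt hC
      · simp only [hrs i h2]
        exact workState_ne_halt _
    · obtain ⟨i, rfl⟩ := Nat.exists_eq_add_of_le h1
      rcases Nat.lt_or_ge (B - 2) i with h2 | h2
      · obtain ⟨i, rfl⟩ := Nat.exists_eq_add_of_lt h2
        rw [show B + (B - 2 + i + 1) = B + (B - 2) + (1 + i) by omega, hshift i (by omega),
          show B - 1 - i = B - 1 - i - 1 + 1 by omega]
        exact ⟨workState_ne_halt _, fun t n => Or.inr rfl⟩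
      · rw [hwrite i h2]
        exact ⟨workState_ne_halt _, hpart _⟩

end BlockMachine

end ITTM

/-! ### The machine that deletes numbers -/

namespace ITTM

namespace BlockMachine

variable {Q K : Type} {B : ℕ} [NeZero B] (e : K ≃ Fin B) [Finite Q] [Finite K]

theorem path_trans (M : BlockMachine Q K) {C D E : BlockConfig Q K}
    (h₁ : (M.toProgram e).Path (M.toConfig e C) (M.toConfig e D))
    (h₂ : (M.toProgram e).Path (M.toConfig e D) (M.toConfig e E))
    (h : ∀ j t k, D.rows j t k = C.rows j t k ∨ D.rows j t k = E.rows j t k) :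
    (M.toProgram e).Path (M.toConfig e C) (M.toConfig e E) :=
  h₁.trans h₂ fun t n => h (n / B) t (e.symm (num n))

/-- A number of steps of a block machine that change no cell twice form a path. -/
theorem path_iterate (M : BlockMachine Q K) (hB : 2 ≤ B) (C : BlockConfig Q K) {k : ℕ} (hk : 0 < k)
    (hs : ∀ i < k, (M.step^[i] C).state ≠ .halt)
    (hr : ∀ i < k, ∀ j t κ, (M.step^[i] C).rows j t κ = C.rows j t κ ∨
      (M.step^[i] C).rows j t κ = (M.step^[i + 1] C).rows j t κ) :
    (M.toProgram e).Path (M.toConfig e C) (M.toConfig e (M.step^[k] C)) := by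
  obtain ⟨k, rfl⟩ : ∃ l, k = l + 1 := ⟨k - 1, by omega⟩
  induction k with
  | zero => exact M.path_step e hB C (hs 0 hk)
  | succ k ih =>
    refine path_trans e M (ih (by omega) (fun i hi => hs i (by omega))
      fun i hi => hr i (by omega)) ?_ (hr (k + 1) (by omega))
    rw [Function.iterate_succ_apply' _ (k + 1)]
    exact M.path_step e hB _ (hs (k + 1) (by omega))

end BlockMachine

namespace Counting

/-- The registers, which hold natural numbers: `idx` and `shell` describe the pair under inspection,
`cand` is the candidate, `cell` is the number of the block that contains the digit of the input
belonging to the pair. -/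
inductive Reg : Type
  | idx
  | shell
  | cand
  | cell
  deriving DecidableEq

/-- The tracks of the scratch tape, each containing one cell of every block: the track `home` marks
the first block, `mark r` holds the register `r` in unary, `diag` is the set of all `n` with
`n ◁ n`, `del` is the set of the numbers deleted so far, and the last three are flags in the first
block. -/
inductive Track : Type
  | home
  | mark (r : Reg)
  | diag
  | del
  | fresh
  | moved
  | left
  deriving DecidableEq

/-- What remains to be done with a register on the way to the right: to find its mark and move it by
one block, to put down the mark found in the preceding block, to find its mark, or nothing. -/
inductive Status : Type
  | move
  | carry
  | seek
  | done
  deriving DecidableEq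

instance : Finite Reg :=
  Finite.of_injective
    (fun r : Reg => match r with | .idx => (0 : Fin 4) | .shell => 1 | .cand => 2 | .cell => 3)
    (by rintro ⟨⟩ ⟨⟩ h <;> first | rfl | simp at h)

noncomputable instance : Fintype Reg := Fintype.ofFinite Reg

instance : Finite Track :=
  Finite.of_injective
    (fun t : Track => match t with
      | .home => (Sum.inl 0 : Fin 6 ⊕ Reg) | .mark r => Sum.inr r | .diag => Sum.inl 1
      | .del => Sum.inl 2 | .fresh => Sum.inl 3 | .moved => Sum.inl 4 | .left => Sum.inl 5)
    (by rintro (_ | r | _ | _ | _ | _ | _) (_ | r' | _ | _ | _ | _ | _) h <;> simp_all)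

instance : Finite Status :=
  Finite.of_injective
    (fun r : Status => match r with | .move => (0 : Fin 4) | .carry => 1 | .seek => 2 | .done => 3)
    (by rintro ⟨⟩ ⟨⟩ h <;> first | rfl | simp at h)

/-- The number of cells in a block. -/
noncomputable def width : ℕ := Nat.card Track

instance : Nontrivial Track := ⟨.home, .diag, nofun⟩

theorem two_le_width : 2 ≤ width := Finite.one_lt_card

instance : NeZero width := ⟨by have := two_le_width; omega⟩

/-- The places of the tracks in a block. -/
noncomputable def place : Track ≃ Fin width := Finite.equivFin Track

/-- What the machine is doing: to inspect pairs, in the first pass (`init`) to fill the track `diag`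
and later to test a candidate, or to delete the candidate. In a shell the column, of the pairs
`(idx, shell)`, comes before the row (`row`), of the pairs `(shell, idx)`; `o` is the place in its
block of the digit of the input that belongs to the pair. -/
inductive Mode : Type
  | scan (init row : Bool) (o : Fin width)
  | erase

/-- The working states: on the way to the right through the blocks, and on the way back. The
machine remembers in `mem r` the block that contains the mark of the register `r`. -/
inductive Walk : Type
  | right (m : Mode) (st : Reg → Status) (setDiag setDel : Bool) (mem : Reg → Block Track)
  | left (m : Mode) (mem : Reg → Block Track)

instance : Finite Mode :=
  Finite.of_injective
    (fun m : Mode => match m with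
      | .scan i r o => (some (i, r, o) : Option (Bool × Bool × Fin width)) | .erase => none)
    (by rintro (_ | _) (_ | _) h <;> simp_all)

instance : Finite Walk :=
  Finite.of_injective
    (fun w : Walk => match w with
      | .right m st f d mem => (Sum.inl (m, st, f, d, mem) :
          (Mode × (Reg → Status) × Bool × Bool × (Reg → Block Track)) ⊕
            (Mode × (Reg → Block Track)))
      | .left m mem => Sum.inr (m, mem))
    (by rintro (_ | _) (_ | _) h <;> simp_all)

/-- An instruction: a mode to continue in, registers to be reset or increased by one, whether to add
the (old) number in `shell` to `diag` and whether to add the number in `cand` to `del`, and values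
of the flags. -/
structure Cmd : Type where
  mode : Mode
  zero : Reg → Bool
  inc : Reg → Bool
  setDiag : Bool
  setDel : Bool
  fresh : Bool
  moved : Bool
  left : Bool

/-- The status after a block, given whether the register has a mark in it. -/
def Status.next : Status → Bool → Status
  | .move, b => if b then .carry else .move
  | .carry, _ => .done
  | .seek, b => if b then .done else .seek
  | .done, _ => .done

/-- The new mark of the register. Marks beyond the first one are erased. -/
def Status.out : Status → Bool → Bool
  | .carry, _ => true
  | .seek, b => b
  | _, _ => false

/-- Whether the block contains the first mark of the register. -/
def Status.found : Status → Bool → Bool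
  | .move, b => b
  | .seek, b => b
  | _, _ => false

/-- The content of the first block when an instruction begins. -/
def issueBlock (c : Cmd) (b : Block Track) : Block Track
  | .scratch => fun
    | .home => true
    | .mark r => b .scratch (.mark r) || c.zero r
    | .diag => b .scratch .diag
    | .del => b .scratch .del
    | .fresh => c.fresh
    | .moved => c.moved
    | .left => c.left
  | t => b t

/-- The beginning of an instruction. A register is reset by a mark in the first block; its former
mark stays but does not count. The move to the left keeps the head on the first block. -/
def issue (c : Cmd) (b : Block Track) : Ctrl Walk × Block Track × Move :=
  (.work (.right c.mode (fun r => if c.inc r then .move else .seek) c.setDiag c.setDel fun _ => b),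
    issueBlock c b, .left)

/-- The new content of a block on the way to the right. -/
def walkBlock (st : Reg → Status) (setDiag setDel : Bool) (b : Block Track) : Block Track
  | .scratch => fun
    | .mark r => (st r).out (b .scratch (.mark r))
    | .diag => b .scratch .diag || (setDiag && (st .shell).found (b .scratch (.mark .shell)))
    | .del => b .scratch .del || (setDel && (st .cand).found (b .scratch (.mark .cand)))
    | k => b .scratch k
  | t => b t

/-- A step on the way to the right, which ends when all marks have been found. -/
noncomputable def walk (m : Mode) (st : Reg → Status) (setDiag setDel : Bool) (mem : Reg → Block Track)
    (b : Block Track) : Ctrl Walk × Block Track × Move :=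
  let st' : Reg → Status := fun r => (st r).next (b .scratch (.mark r))
  let b' := walkBlock st setDiag setDel b
  let mem' : Reg → Block Track := fun r => if st r ≠ .done ∧ st' r = .done then b' else mem r
  if ∀ r, st' r = .done then (.work (.left m mem'), b', .left)
  else (.work (.right m st' setDiag setDel mem'), b', .right)

/-- The instruction that begins the first pass. -/
noncomputable def startCmd : Cmd :=
  ⟨.scan true false 0, fun _ => true, fun _ => false, false, false, true, false, false⟩

/-- The instruction that begins the test of the candidates in turn, after a deletion. -/
noncomputable def restartCmd : Cmd :=
  ⟨.scan false false 0, fun _ => true, fun _ => false, false, false, false, false, false⟩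

/-- The instruction to delete the candidate. -/
def eraseCmd : Cmd :=
  ⟨.erase, fun r => r ≠ .cand, fun _ => false, false, true, true, false, false⟩

/-- Whether the pair `(a, b)` speaks against the candidate `c`. The arguments tell whether `a = c`,
`b = c`, `a ◁ a`, `b ◁ b`, whether `a` and `b` have been deleted, and whether `a ◁ b`. -/
def badPair (ac bc fa fb da db x : Bool) : Bool :=
  ((ac || bc) && x && !(fa && fb)) || (ac && fa && fb && !db && !x) ||
    (bc && !ac && fa && fb && !da && x)

/-- The instruction given when a pair has been inspected. -/
noncomputable def scanCmd (init row : Bool) (o : Fin width) (mem : Reg → Block Track) (lf : Bool) :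
    Cmd :=
  let bit (r : Reg) (k : Track) : Bool := mem r .scratch k
  let eq : Bool := bit .idx (.mark .shell)
  let x : Bool := mem .cell .input (place.symm o)
  let bad : Bool := !init && (bit .cand .del || ((row || !eq) &&
    if row then
      badPair (bit .shell (.mark .cand)) (bit .idx (.mark .cand)) (bit .shell .diag)
        (bit .idx .diag) (bit .shell .del) (bit .idx .del) x
    else
      badPair (bit .idx (.mark .cand)) (bit .shell (.mark .cand)) (bit .idx .diag)
        (bit .shell .diag) (bit .idx .del) (bit .shell .del) x))
  let lf' : Bool := lf || !bit .cand .del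
  let o' : Fin width := if o.val + 1 < width then BlockMachine.num (o + 1) else 0
  let wrap : Bool := !decide (o.val + 1 < width)
  if bad then
    ⟨.scan init false 0, fun r => r ≠ .cand, fun r => r = .cand, false, false, init, true, lf'⟩
  else if eq then
    if row then
      ⟨.scan init false o', fun r => r = .idx, fun r => r = .shell || (r = .cell && wrap),
        init && x, false, init, false, lf'⟩
    else ⟨.scan init true o, fun r => r = .idx, fun _ => false, false, false, init, false, lf'⟩
  else
    ⟨.scan init row o', fun _ => false, fun r => r = .idx || (r = .cell && wrap), false, false,
      init, false, lf'⟩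

/-- The instruction given on the return to the first block. -/
noncomputable def nextCmd (mem : Reg → Block Track) (lf : Bool) : Mode → Cmd
  | .scan init row o => scanCmd init row o mem lf
  | .erase => restartCmd

/-- The answer, in the first cell of the output tape: `1` if nothing is left. -/
noncomputable def answer (b : Block Track) : Block Track
  | .output => Function.update (b .output) (place.symm 0) (!b .scratch .left)
  | t => b t

/-- The machine that deletes, one after another, the least remaining numbers. -/
noncomputable def machine : BlockMachine Walk Track where
  table s b :=
    match s with
    | .start => issue startCmd b
    | .limit =>
      if b .scratch .fresh then issue restartCmd b
      else if b .scratch .moved then (.halt, answer b, .left)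
      else issue eraseCmd b
    | .halt => (.halt, b, .left)
    | .work (.right m st f d mem) => walk m st f d mem b
    | .work (.left m mem) =>
      if b .scratch .home then issue (nextCmd mem (b .scratch .left) m) b
      else (.work (.left m mem), b, .left)

/-- The program for the machine. -/
noncomputable abbrev program : Program := machine.toProgram place

/-- A configuration of the machine as one of the program. -/
noncomputable abbrev conf (C : BlockConfig Walk Track) : Config program.numStates :=
  machine.toConfig place C

/-- The first element of a set, given by its characteristic function. -/
def IsFirst (t : ℕ → Bool) (v : ℕ) : Prop := t v = true ∧ ∀ j < v, t j = false

/-- The content of the tapes, but for the registers and the flags, when `F` is on the track `diag`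
and `D` on the track `del`. -/
structure Sheet (x : CantorReal) (F D : ℕ → Bool) (R : ℕ → Block Track) : Prop where
  input : ∀ j k, R j .input k = x (j * width + place k)
  output : ∀ j k, R j .output k = false
  home : ∀ j, R (j + 1) .scratch .home = false
  diag : ∀ j, R j .scratch .diag = F j
  del : ∀ j, R j .scratch .del = D j

/-- The machine is back on the first block, with the numbers `v` in the registers and `g`, `h`, `l`
in the flags. -/
structure AtHome (x : CantorReal) (F D : ℕ → Bool) (m : Mode) (v : Reg → ℕ) (g h l : Bool)
    (C : BlockConfig Walk Track) : Prop where
  state : ∃ mem, C.state = .work (.left m mem) ∧ ∀ r, mem r = C.rows (v r)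
  head : C.head = 0
  sheet : Sheet x F D C.rows
  home : C.rows 0 .scratch .home = true
  first : ∀ r, IsFirst (fun j => C.rows j .scratch (.mark r)) (v r)
  clean : ∀ r r', C.rows (v r) .scratch (.mark r') = decide (v r = v r')
  fresh : C.rows 0 .scratch .fresh = g
  moved : C.rows 0 .scratch .moved = h
  left : C.rows 0 .scratch .left = l

/-- The status of a register with first mark `v` when the head is on block `j` on its way to the
right. -/
def statusAt (inc : Bool) (v j : ℕ) : Status :=
  if inc then if j ≤ v then .move else if j = v + 1 then .carry else .done
  else if j ≤ v then .seek else .done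

theorem statusAt_next {inc b : Bool} {v j : ℕ} (h₁ : j < v → b = false) (h₂ : j = v → b = true) :
    (statusAt inc v j).next b = statusAt inc v (j + 1) := by
  rcases lt_trichotomy j v with h | h | h
  · have : j ≤ v := h.le
    cases inc <;> simp [statusAt, Status.next, h₁ h, this, h]
  · subst h
    cases inc <;> simp [statusAt, Status.next, h₂ rfl]
  · have h3 : ¬ j ≤ v := by omega
    have h4 : ¬ j + 1 ≤ v := by omega
    have h5 : j ≠ v := by omega
    have h6 : ¬ j < v := by omega
    cases inc
    · simp [statusAt, Status.next, h3, h6]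
    · by_cases h7 : j = v + 1 <;> simp [statusAt, Status.next, h3, h5, h6, h7]

theorem statusAt_out {inc b : Bool} {v j : ℕ} (h₁ : j < v → b = false) (h₂ : j = v → b = true) :
    (statusAt inc v j).out b = decide (j = v + inc.toNat) := by
  rcases lt_trichotomy j v with h | h | h
  · have : j ≤ v := h.le
    have h2 : j ≠ v + 1 := by omega
    cases inc <;> simp [statusAt, Status.out, h₁ h, this, h2, h.ne]
  · subst h
    cases inc <;> simp [statusAt, Status.out, h₂ rfl]
  · have h3 : ¬ j ≤ v := by omega
    have h5 : j ≠ v := by omega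
    cases inc
    · simp [statusAt, Status.out, h3, h5]
    · by_cases h7 : j = v + 1 <;> simp [statusAt, Status.out, h3, h7]

theorem statusAt_found {inc b : Bool} {v j : ℕ} (h₁ : j < v → b = false) (h₂ : j = v → b = true) :
    (statusAt inc v j).found b = decide (j = v) := by
  rcases lt_trichotomy j v with h | h | h
  · have : j ≤ v := h.le
    cases inc <;> simp [statusAt, Status.found, h₁ h, this, h.ne]
  · subst h
    cases inc <;> simp [statusAt, Status.found, h₂ rfl]
  · have h3 : ¬ j ≤ v := by omega
    have h5 : j ≠ v := by omega
    cases inc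
    · simp [statusAt, Status.found, h3, h5]
    · by_cases h7 : j = v + 1 <;> simp [statusAt, Status.found, h3, h5, h7]

theorem statusAt_eq_done {inc : Bool} {v j : ℕ} :
    statusAt inc v j = .done ↔ v + inc.toNat < j := by
  cases inc
  · by_cases h : j ≤ v <;> simp [statusAt, h]; omega
  · by_cases h : j ≤ v
    · simp [statusAt, h]; omega
    · by_cases h' : j = v + 1
      · simp [statusAt, h']
      · simp [statusAt, h, h']; omega

/-- Block `j` after the way to the right, when the registers had the first marks `v`. -/
def newBlock (v : Reg → ℕ) (inc : Reg → Bool) (setDiag setDel : Bool) (R : ℕ → Block Track)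
    (j : ℕ) : Block Track
  | .scratch => fun
    | .mark r => decide (j = v r + (inc r).toNat)
    | .diag => R j .scratch .diag || (setDiag && decide (j = v .shell))
    | .del => R j .scratch .del || (setDel && decide (j = v .cand))
    | k => R j .scratch k
  | t => R j t

theorem walkBlock_eq {v : Reg → ℕ} {inc : Reg → Bool} {setDiag setDel : Bool} {R : ℕ → Block Track}
    (hv : ∀ r, IsFirst (fun j => R j .scratch (.mark r)) (v r)) (j : ℕ) :
    walkBlock (fun r => statusAt (inc r) (v r) j) setDiag setDel (R j) =
      newBlock v inc setDiag setDel R j := by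
  have h₁ : ∀ r, j < v r → R j .scratch (.mark r) = false := fun r h => (hv r).2 j h
  have h₂ : ∀ r, j = v r → R j .scratch (.mark r) = true := fun r h => by rw [h]; exact (hv r).1
  funext t k
  rcases t with _ | _ | _
  · rfl
  · cases k with
    | mark r => exact statusAt_out (h₁ r) (h₂ r)
    | diag => simp only [walkBlock, newBlock, statusAt_found (h₁ .shell) (h₂ .shell)]
    | del => simp only [walkBlock, newBlock, statusAt_found (h₁ .cand) (h₂ .cand)]
    | _ => rfl
  · rfl

/-- The way to the right. -/
theorem walk_right {v : Reg → ℕ} {inc : Reg → Bool} {f d : Bool} {R : ℕ → Block Track} {m : Mode}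
    {mem : Reg → Block Track} (hv : ∀ r, IsFirst (fun j => R j .scratch (.mark r)) (v r)) :
    ∃ (L : ℕ) (mem' : Reg → Block Track), (∀ r, v r + (inc r).toNat ≤ L) ∧
      (∀ r, mem' r = newBlock v inc f d R (v r + (inc r).toNat)) ∧
      program.Path
        (conf ⟨.work (.right m (fun r => if inc r then .move else .seek) f d mem), 0, R⟩)
        (conf ⟨.work (.left m mem'), L - 1,
          fun i => if i ≤ L then newBlock v inc f d R i else R i⟩) := by
  let L := Finset.univ.sup fun r => v r + (inc r).toNat
  have hL : ∀ r, v r + (inc r).toNat ≤ L := fun r =>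
    Finset.le_sup (f := fun r => v r + (inc r).toNat) (Finset.mem_univ r)
  -- what is remembered when the head arrives at block `j`
  let memAt : ℕ → Reg → Block Track := fun j r =>
    if v r + (inc r).toNat < j then newBlock v inc f d R (v r + (inc r).toNat) else mem r
  let C : ℕ → BlockConfig Walk Track := fun j =>
    ⟨.work (.right m (fun r => statusAt (inc r) (v r) j) f d (memAt j)), j,
      fun i => if i < j then newBlock v inc f d R i else R i⟩
  have hnext : ∀ j r, (statusAt (inc r) (v r) j).next (R j .scratch (.mark r)) =
      statusAt (inc r) (v r) (j + 1) := fun j r =>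
    statusAt_next (fun h => (hv r).2 j h) (fun h => by rw [h]; exact (hv r).1)
  have hmem : ∀ j, (fun r => if ¬ (v r + (inc r).toNat < j) ∧
      v r + (inc r).toNat < j + 1 then newBlock v inc f d R j else memAt j r) =
      memAt (j + 1) := by
    intro j
    funext r
    simp only [memAt]
    rcases lt_trichotomy (v r + (inc r).toNat) j with h | h | h
    · rw [if_neg (by omega), if_pos h, if_pos (by omega)]
    · rw [if_pos (by omega), if_pos (by omega), h]
    · rw [if_neg (by omega), if_neg (by omega), if_neg (by omega)]
  have hrows : ∀ j, Function.update (fun i => if i < j then newBlock v inc f d R i else R i) j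
      (newBlock v inc f d R j) = fun i => if i < j + 1 then newBlock v inc f d R i else R i := by
    intro j
    funext i
    rcases eq_or_ne i j with rfl | h
    · simp
    · rw [Function.update_of_ne h]
      have : i < j + 1 ↔ i < j := by omega
      simp only [this]
  have hstep : ∀ j, machine.step (C j) = if ∀ r, v r + (inc r).toNat < j + 1 then
      ⟨.work (.left m (memAt (j + 1))), j - 1, (C (j + 1)).rows⟩ else C (j + 1) := by
    intro j
    simp only [BlockMachine.step, machine, C, walk, lt_irrefl, if_false, walkBlock_eq hv, hnext,
      ne_eq, statusAt_eq_done, hmem]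
    split_ifs with h <;> simp only [hrows, Move.act]
  have hC : ∀ j, j ≤ L → machine.step^[j] (C 0) = C j := by
    intro j
    induction j with
    | zero => intro _; rfl
    | succ j ih =>
      intro hj
      rw [Function.iterate_succ_apply', ih (by omega), hstep, if_neg]
      intro h
      have : L ≤ j := Finset.sup_le fun r _ => Nat.lt_succ_iff.1 (h r)
      omega
  have hlast : machine.step^[L + 1] (C 0) =
      ⟨.work (.left m (memAt (L + 1))), L - 1, (C (L + 1)).rows⟩ := by
    rw [Function.iterate_succ_apply', hC L le_rfl, hstep, if_pos fun r => Nat.lt_succ_of_le (hL r)]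
  refine ⟨L, memAt (L + 1), hL, fun r => if_pos (Nat.lt_succ_of_le (hL r)), ?_⟩
  have h0 : (⟨.work (.right m (fun r => if inc r then .move else .seek) f d mem), 0, R⟩ :
      BlockConfig Walk Track) = C 0 := by
    simp [C, statusAt, memAt]
  have h1 : (C (L + 1)).rows = fun i => if i ≤ L then newBlock v inc f d R i else R i := by
    funext i
    simp only [C, Nat.lt_succ_iff]
  rw [h0, ← h1, ← hlast]
  refine machine.path_iterate place two_le_width (C 0) (by omega) (fun i hi => ?_)
    fun i hi j t k => ?_
  · rw [hC i (by omega)]; exact nofun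
  · have h2 : (machine.step^[i + 1] (C 0)).rows = (C (i + 1)).rows := by
      rcases Nat.lt_or_ge i L with h | h
      · rw [hC _ (by omega)]
      · rw [show i = L by omega, hlast]
    rw [h2, hC i (by omega)]
    simp only [C, Nat.not_lt_zero, if_false]
    rcases lt_trichotomy j i with h | rfl | h
    · right; rw [if_pos h, if_pos (by omega)]
    · left; rw [if_neg (lt_irrefl _)]
    · left; rw [if_neg (by omega)]

/-- The way back to the first block. -/
theorem walk_left {m : Mode} {mem : Reg → Block Track} {R : ℕ → Block Track}
    (hR : ∀ j, R (j + 1) .scratch .home = false) (j : ℕ) :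
    j = 0 ∨ program.Path (conf ⟨.work (.left m mem), j, R⟩) (conf ⟨.work (.left m mem), 0, R⟩) := by
  have hstep : ∀ j, machine.step ⟨.work (.left m mem), j + 1, R⟩ = ⟨.work (.left m mem), j, R⟩ := by
    intro j
    simp [BlockMachine.step, machine, hR, Move.act]
  induction j with
  | zero => exact Or.inl rfl
  | succ j ih =>
    right
    have h := machine.path_step place two_le_width ⟨.work (.left m mem), j + 1, R⟩ nofun
    rw [hstep] at h
    rcases ih with rfl | ih
    · exact h
    · exact machine.path_trans place h ih fun _ _ _ => Or.inl rfl

/-- The execution of an instruction. -/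
theorem exists_path_of_issue {x : CantorReal} {F D : ℕ → Bool} {C : BlockConfig Walk Track} {c : Cmd}
    {v : Reg → ℕ} (hs : C.state ≠ .halt) (h0 : C.head = 0) (hS : Sheet x F D C.rows)
    (hc : machine.table C.state (C.rows 0) = issue c (C.rows 0))
    (hv : ∀ r, c.zero r = false → IsFirst (fun j => C.rows j .scratch (.mark r)) (v r))
    (hz : ∀ r, c.zero r = true → v r = 0 ∧ c.inc r = false) :
    ∃ C', program.Path (conf C) (conf C') ∧
      AtHome x (fun j => F j || (c.setDiag && decide (j = v .shell)))
        (fun j => D j || (c.setDel && decide (j = v .cand))) c.mode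
        (fun r => v r + (c.inc r).toNat) c.fresh c.moved c.left C' := by
  obtain ⟨s, j, R⟩ := C
  obtain rfl : j = 0 := h0
  simp only at hs hS hc hv
  let R₁ := Function.update R 0 (issueBlock c (R 0))
  have h₁ := machine.path_step place two_le_width ⟨s, 0, R⟩ hs
  have hstep : machine.step ⟨s, 0, R⟩ = ⟨.work (.right c.mode
      (fun r => if c.inc r then .move else .seek) c.setDiag c.setDel fun _ => R 0), 0, R₁⟩ := by
    simp only [BlockMachine.step, hc, issue, Move.act]
    rfl
  rw [hstep] at h₁
  have hR0 : R₁ 0 = issueBlock c (R 0) := Function.update_self _ _ _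
  have hRpos : ∀ j, j ≠ 0 → R₁ j = R j := fun j hj => Function.update_of_ne hj _ _
  -- the first block keeps its content on the tracks `diag` and `del` and on the other tapes
  have hkeep : ∀ j t k, (∀ T, t = .scratch → k = T → T = .diag ∨ T = .del) →
      R₁ j t k = R j t k := by
    intro j t k hk
    rcases eq_or_ne j 0 with rfl | hj
    · rw [hR0]
      rcases t with _ | _ | _
      · rfl
      · rcases hk k rfl rfl with rfl | rfl <;> rfl
      · rfl
    · rw [hRpos j hj]
  have hmark : ∀ j r, R₁ j .scratch (.mark r) =
      (R j .scratch (.mark r) || (decide (j = 0) && c.zero r)) := by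
    intro j r
    rcases eq_or_ne j 0 with rfl | hj
    · rw [hR0]; simp [issueBlock]
    · rw [hRpos j hj]; simp [hj]
  have hv₁ : ∀ r, IsFirst (fun j => R₁ j .scratch (.mark r)) (v r) := by
    intro r
    cases hzr : c.zero r with
    | false =>
      have := hv r hzr
      unfold IsFirst at this ⊢
      simpa only [hmark, hzr, Bool.and_false, Bool.or_false] using this
    | true =>
      rw [(hz r hzr).1]
      refine ⟨?_, fun j hj => absurd hj (by omega)⟩
      simp only [hmark, hzr]
      simp
  obtain ⟨L, mem, hL, hmem, h₂⟩ := walk_right (m := c.mode) (inc := c.inc) (f := c.setDiag)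
    (d := c.setDel) (mem := fun _ => R 0) hv₁
  set R₂ : ℕ → Block Track := fun i =>
    if i ≤ L then newBlock v c.inc c.setDiag c.setDel R₁ i else R₁ i with hR₂
  have hin : ∀ j k, R₂ j .input k = R₁ j .input k := by
    intro j k; simp only [hR₂]; split_ifs <;> rfl
  have hout : ∀ j k, R₂ j .output k = R₁ j .output k := by
    intro j k; simp only [hR₂]; split_ifs <;> rfl
  have hother : ∀ j k, (∀ r, k ≠ .mark r) → k ≠ .diag → k ≠ .del →
      R₂ j .scratch k = R₁ j .scratch k := by
    intro j k h1 h2 h3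
    simp only [hR₂]
    split_ifs
    · cases k with
      | mark r => exact absurd rfl (h1 r)
      | diag => exact absurd rfl h2
      | del => exact absurd rfl h3
      | _ => rfl
    · rfl
  have hvL : ∀ r, v r ≤ L := fun r => le_trans (Nat.le_add_right _ _) (hL r)
  have hmark₂ : ∀ j r, j ≤ L → R₂ j .scratch (.mark r) = decide (j = v r + (c.inc r).toNat) := by
    intro j r hj
    simp only [hR₂, if_pos hj]
    rfl
  have hS₂ : Sheet x (fun j => F j || (c.setDiag && decide (j = v .shell)))
      (fun j => D j || (c.setDel && decide (j = v .cand))) R₂ := by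
    refine ⟨fun j k => ?_, fun j k => ?_, fun j => ?_, fun j => ?_, fun j => ?_⟩
    · rw [hin, hkeep _ _ _ (by simp), hS.input]
    · rw [hout, hkeep _ _ _ (by simp), hS.output]
    · rw [hother _ _ (by simp) (by simp) (by simp), hRpos _ (by omega), hS.home]
    · simp only [hR₂]
      split_ifs with h
      · simp only [newBlock]
        rw [hkeep _ _ _ (by simp), hS.diag]
      · have := hvL .shell
        rw [hkeep _ _ _ (by simp), hS.diag, decide_eq_false (by omega)]
        simp
    · simp only [hR₂]
      split_ifs with h
      · simp only [newBlock]
        rw [hkeep _ _ _ (by simp), hS.del]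
      · have := hvL .cand
        rw [hkeep _ _ _ (by simp), hS.del, decide_eq_false (by omega)]
        simp
  have hzero : ∀ k, (∀ r, k ≠ .mark r) → k ≠ .diag → k ≠ .del →
      R₂ 0 .scratch k = issueBlock c (R 0) .scratch k := fun k h1 h2 h3 => by
    rw [hother 0 k h1 h2 h3, hR0]
  refine ⟨⟨.work (.left c.mode mem), 0, R₂⟩, ?_, ⟨mem, rfl, fun r => ?_⟩, rfl, hS₂, ?_, ?_, ?_,
    ?_, ?_, ?_⟩
  · have h₃ : program.Path (conf ⟨.work (.right c.mode
        (fun r => if c.inc r then .move else .seek) c.setDiag c.setDel fun _ => R 0), 0, R₁⟩)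
        (conf ⟨.work (.left c.mode mem), 0, R₂⟩) := by
      rcases walk_left (m := c.mode) (mem := mem) hS₂.home (L - 1) with h | h
      · rwa [h] at h₂
      · exact machine.path_trans place h₂ h fun _ _ _ => Or.inr rfl
    refine machine.path_trans place h₁ h₃ fun j t k => ?_
    change R₁ j t k = R j t k ∨ R₁ j t k = R₂ j t k
    by_cases hk : ∀ T, t = .scratch → k = T → T = .diag ∨ T = .del
    · exact Or.inl (hkeep j t k hk)
    · push Not at hk
      obtain ⟨T, rfl, rfl, h1, h2⟩ := hk
      by_cases h3 : ∃ r, k = .mark r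
      · obtain ⟨r, rfl⟩ := h3
        -- a mark put down by a reset stays, since the register is not increased
        by_cases h4 : j = 0 ∧ c.zero r = true
        · obtain ⟨rfl, h4⟩ := h4
          right
          rw [hmark₂ _ _ (by omega), hmark, h4, (hz r h4).1, (hz r h4).2]
          simp
        · left
          rw [hmark]
          by_cases hj : j = 0
          · have : c.zero r = false := by simpa [hj] using h4
            simp [this]
          · simp [hj]
      · exact Or.inr (hother j k (fun r hr => h3 ⟨r, hr⟩) h1 h2).symm
  · rw [hmem]
    simp only [hR₂, if_pos (hL r)]
  · exact hzero .home nofun nofun nofun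
  · refine fun r => ⟨?_, fun j hj => ?_⟩
    · simp only [hmark₂ _ _ (hL r), decide_true]
    · have := hL r
      simp only [hmark₂ j r (by omega)]
      exact decide_eq_false (by omega)
  · exact fun r r' => hmark₂ _ _ (hL r)
  · exact hzero .fresh nofun nofun nofun
  · exact hzero .moved nofun nofun nofun
  · exact hzero .left nofun nofun nofun

end Counting

end ITTM

/-! ### The enumeration of pairs -/

namespace ITTM

namespace Counting

/-- A place in the enumeration of all pairs by shells: in shell `s` come the pairs `(i, s)`, the
column, and then the pairs `(s, i)`, the row. The column ends with a dummy place, where `i = s`. -/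
structure Pos : Type where
  row : Bool
  i : ℕ
  s : ℕ

namespace Pos

/-- The first place. -/
def first : Pos := ⟨false, 0, 0⟩

/-- The next place. -/
def next (q : Pos) : Pos :=
  if q.i = q.s then if q.row then ⟨false, 0, q.s + 1⟩ else ⟨true, 0, q.s⟩ else ⟨q.row, q.i + 1, q.s⟩

/-- The index of the digit of the input belonging to the place. -/
def code (q : Pos) : ℕ := q.s * q.s + (if q.row then q.s else 0) + q.i

/-- The first member of the pair at the place. -/
def fst (q : Pos) : ℕ := if q.row then q.s else q.i

/-- The second member of the pair at the place. -/
def snd (q : Pos) : ℕ := if q.row then q.i else q.s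

theorem next_le {q : Pos} (h : q.i ≤ q.s) : q.next.i ≤ q.next.s := by
  unfold next
  split_ifs
  · simp
  · simp
  · simp only; omega

theorem code_eq_pair {q : Pos} (h : q.i ≤ q.s) (hd : q.row = true ∨ q.i ≠ q.s) :
    q.code = Nat.pair q.fst q.snd := by
  obtain ⟨row, i, s⟩ := q
  simp only at h hd
  cases row
  · have : i < s := by simp at hd; omega
    simp [code, fst, snd, Nat.pair, this]
  · simp [code, fst, snd, Nat.pair, Nat.not_lt.2 h]

theorem exists_iterate_next (q : Pos) (h : q.i ≤ q.s) : ∃ t, next^[t] first = q := by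
  have key : ∀ s, (∃ t, next^[t] first = ⟨false, 0, s⟩) →
      ∀ row, ∃ t, next^[t] first = ⟨row, 0, s⟩ ∧ ∀ i ≤ s, next^[i] ⟨row, 0, s⟩ = ⟨row, i, s⟩ := by
    intro s hs
    have hi : ∀ row, ∀ i ≤ s, next^[i] ⟨row, 0, s⟩ = ⟨row, i, s⟩ := by
      intro row i
      induction i with
      | zero => intro _; rfl
      | succ i ih =>
        intro hi
        rw [Function.iterate_succ_apply', ih (by omega)]
        simp only [next]
        rw [if_neg (by omega)]
    obtain ⟨t, ht⟩ := hs
    rintro (_ | _)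
    · exact ⟨t, ht, hi _⟩
    · refine ⟨(s + 1) + t, ?_, hi _⟩
      rw [Function.iterate_add_apply, ht, Function.iterate_succ_apply', hi _ _ le_rfl]
      simp [next]
  have hs : ∀ s, ∃ t, next^[t] first = ⟨false, 0, s⟩ := by
    intro s
    induction s with
    | zero => exact ⟨0, rfl⟩
    | succ s ih =>
      obtain ⟨t, ht, hi⟩ := key s ih true
      refine ⟨(s + 1) + t, ?_⟩
      rw [Function.iterate_add_apply, ht, Function.iterate_succ_apply', hi _ le_rfl]
      simp [next]
  obtain ⟨t, ht, hi⟩ := key q.s (hs _) q.row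
  exact ⟨q.i + t, by rw [Function.iterate_add_apply, ht, hi _ h]⟩

end Pos

/-- The contents of the registers when the candidate `c` is tested at the place `q`. -/
noncomputable def regs (q : Pos) (c : ℕ) : Reg → ℕ
  | .idx => q.i
  | .shell => q.s
  | .cand => c
  | .cell => q.code / width

/-- The mode when the machine is at the place `q`. -/
noncomputable def scanMode (init : Bool) (q : Pos) : Mode :=
  .scan init q.row ⟨q.code % width, Nat.mod_lt _ (NeZero.pos width)⟩

/-- Whether the place `q` speaks against the candidate `c`. -/
def bad (x : CantorReal) (F D : ℕ → Bool) (q : Pos) (c : ℕ) : Bool :=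
  D c || ((q.row || !decide (q.i = q.s)) &&
    badPair (decide (q.fst = c)) (decide (q.snd = c)) (F q.fst) (F q.snd) (D q.fst) (D q.snd)
      (x (Nat.pair q.fst q.snd)))

/-- What varies while pairs are inspected: the track `diag`, the place, the candidate and the
flags. -/
structure Scan : Type where
  F : ℕ → Bool
  q : Pos
  c : ℕ
  g : Bool
  h : Bool
  l : Bool

/-- The effect of the inspection of a pair. -/
def Scan.next (x : CantorReal) (D : ℕ → Bool) (init : Bool) (σ : Scan) : Scan :=
  if !init && bad x σ.F D σ.q σ.c then ⟨σ.F, Pos.first, σ.c + 1, init, true, σ.l || !D σ.c⟩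
  else ⟨fun j => σ.F j || ((init && σ.q.row && decide (σ.q.i = σ.q.s) &&
      x (Nat.pair σ.q.s σ.q.s)) && decide (j = σ.q.s)), σ.q.next, σ.c, init, false, σ.l || !D σ.c⟩

/-- The machine is on the first block and about to inspect a pair. -/
def Scanning (x : CantorReal) (D : ℕ → Bool) (init : Bool) (σ : Scan)
    (C : BlockConfig Walk Track) : Prop :=
  σ.q.i ≤ σ.q.s ∧ AtHome x σ.F D (scanMode init σ.q) (regs σ.q σ.c) σ.g σ.h σ.l C

theorem succ_mod_width (n : ℕ) :
    (if n % width + 1 < width then BlockMachine.num (n % width + 1) else (0 : Fin width)) =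
      ⟨(n + 1) % width, Nat.mod_lt _ (NeZero.pos width)⟩ := by
  have hw : 0 < width := NeZero.pos width
  have hn := Nat.mod_lt n hw
  have h1 : (n + 1) % width = (n % width + 1) % width := by simp
  split_ifs with h
  · ext
    rw [BlockMachine.val_num h]
    simp only [h1, Nat.mod_eq_of_lt h]
  · ext
    simp only [h1, show n % width + 1 = width by omega, Nat.mod_self]
    rfl

theorem succ_div_width (n : ℕ) :
    n / width + (!decide (n % width + 1 < width)).toNat = (n + 1) / width := by
  have hw : 0 < width := NeZero.pos width
  have hn := Nat.mod_lt n hw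
  have hd := Nat.div_add_mod n width
  by_cases h : n % width + 1 < width
  · have : (n + 1) / width = n / width := by
      rw [show n + 1 = n % width + 1 + width * (n / width) by omega, Nat.add_mul_div_left _ _ hw,
        Nat.div_eq_of_lt h, Nat.zero_add]
    simp [h, this]
  · have : (n + 1) / width = n / width + 1 := by
      rw [show n + 1 = 0 + width * (n / width + 1) by rw [Nat.mul_add]; omega,
        Nat.add_mul_div_left _ _ hw, Nat.zero_div, Nat.zero_add]
    simp [h, this]

/-- The inspection of a pair. -/
theorem exists_path_scan {x : CantorReal} {D : ℕ → Bool} {init : Bool} {σ : Scan}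
    {C : BlockConfig Walk Track} (h : Scanning x D init σ C) :
    ∃ C', program.Path (conf C) (conf C') ∧ Scanning x D init (σ.next x D init) C' := by
  obtain ⟨F, q, c, g, hh, l⟩ := σ
  obtain ⟨hq, h⟩ := h
  simp only at hq h
  obtain ⟨mem, hstate, hmem⟩ := h.state
  have hmark : ∀ r r', mem r .scratch (.mark r') = decide (regs q c r = regs q c r') :=
    fun r r' => by rw [hmem, h.clean]
  have hdiag : ∀ r, mem r .scratch .diag = F (regs q c r) := fun r => by rw [hmem, h.sheet.diag]
  have hdel : ∀ r, mem r .scratch .del = D (regs q c r) := fun r => by rw [hmem, h.sheet.del]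
  have hx : mem .cell .input (place.symm ⟨q.code % width, Nat.mod_lt _ (NeZero.pos width)⟩) =
      x q.code := by
    rw [hmem, h.sheet.input, Equiv.apply_symm_apply]
    simp only [regs]
    rw [Nat.div_add_mod']
  have hbad : (D c || ((q.row || !decide (q.i = q.s)) &&
      if q.row then
        badPair (decide (q.s = c)) (decide (q.i = c)) (F q.s) (F q.i) (D q.s) (D q.i) (x q.code)
      else
        badPair (decide (q.i = c)) (decide (q.s = c)) (F q.i) (F q.s) (D q.i) (D q.s) (x q.code))) =
      bad x F D q c := by
    unfold bad
    congr 1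
    by_cases hd : q.row = true ∨ q.i ≠ q.s
    · rw [← Pos.code_eq_pair hq hd]
      cases hr : q.row <;> simp [Pos.fst, Pos.snd, hr]
    · have : (q.row || !decide (q.i = q.s)) = false := by simpa using hd
      rw [this]; rfl
  set cmd := scanCmd init q.row ⟨q.code % width, Nat.mod_lt _ (NeZero.pos width)⟩ mem l with hcmd
  have hcmd' := hcmd
  have e1 : mem .idx .scratch (.mark .shell) = decide (q.i = q.s) := hmark _ _
  have e2 : mem .idx .scratch (.mark .cand) = decide (q.i = c) := hmark _ _
  have e3 : mem .shell .scratch (.mark .cand) = decide (q.s = c) := hmark _ _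
  simp only [scanCmd, e1, e2, e3, hdiag, hdel, hx, regs, hbad] at hcmd'
  have htable : machine.table C.state (C.rows 0) = issue cmd (C.rows 0) := by
    simp only [machine, hstate, h.home, h.left, if_true, scanMode, nextCmd]
    rfl
  have hs : C.state ≠ .halt := by rw [hstate]; exact nofun
  by_cases hb : (!init && bad x F D q c) = true
  · rw [if_pos hb] at hcmd'
    have hinit : init = false := by
      cases init
      · rfl
      · simp at hb
    obtain ⟨C', hp, hC'⟩ := exists_path_of_issue (v := regs ⟨false, 0, 0⟩ c) hs h.head h.sheet htable
      (fun r hr => by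
        have : r = .cand := by simpa [hcmd'] using hr
        subst this
        exact h.first .cand)
      (fun r hr => by
        have : r ≠ .cand := by simpa [hcmd'] using hr
        refine ⟨?_, by simp [hcmd', this]⟩
        cases r with
        | cand => exact absurd rfl this
        | _ => simp [regs, Pos.code])
    refine ⟨C', hp, ?_⟩
    simp only [Scan.next, if_pos hb]
    refine ⟨le_rfl, ?_⟩
    simp only [hcmd', hinit, Bool.false_and, Bool.or_false] at hC'
    convert hC' using 1
    · simp only [scanMode, Pos.first, Mode.scan.injEq, hinit, true_and]
      ext
      simp [Pos.code]
    · funext r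
      cases r <;> simp [regs, Pos.first]
  · rw [if_neg hb] at hcmd'
    by_cases he : q.i = q.s
    · rw [if_pos (by simpa using he)] at hcmd'
      by_cases hr : q.row = true
      · rw [if_pos hr] at hcmd'
        have hcode : q.next.code = q.code + 1 := by
          simp only [Pos.next, Pos.code, if_pos hr, he]
          simp
          ring
        obtain ⟨C', hp, hC'⟩ := exists_path_of_issue
          (v := fun r => if r = .idx then 0 else regs q c r) hs h.head h.sheet htable
          (fun r hz => by
            have : r ≠ .idx := by simpa [hcmd'] using hz
            simp only [if_neg this]
            exact h.first r)
          (fun r hz => by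
            have : r = .idx := by simpa [hcmd'] using hz
            subst this
            simp [hcmd'])
        refine ⟨C', hp, ?_⟩
        simp only [Scan.next, if_neg hb]
        refine ⟨Pos.next_le hq, ?_⟩
        have hpair : Nat.pair q.s q.s = q.code := by
          rw [Pos.code_eq_pair hq (Or.inl hr)]; simp [Pos.fst, Pos.snd, hr, he]
        simp only [hcmd', Bool.false_and, Bool.or_false, succ_mod_width] at hC'
        convert hC' using 1
        · funext j
          simp [hr, he, hpair, regs]
        · have : q.next.row = false := by simp [Pos.next, he, hr]
          simp only [scanMode, this, hcode]
        · funext r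
          cases r
          · simp [regs, Pos.next, he, hr]
          · simp [regs, Pos.next, he, hr]
          · simp [regs]
          · simp only [regs, hcode, ← succ_div_width]
            simp
      · rw [if_neg hr] at hcmd'
        have hcode : q.next.code = q.code := by
          simp [Pos.next, Pos.code, he, hr]
        obtain ⟨C', hp, hC'⟩ := exists_path_of_issue
          (v := fun r => if r = .idx then 0 else regs q c r) hs h.head h.sheet htable
          (fun r hz => by
            have : r ≠ .idx := by simpa [hcmd'] using hz
            simp only [if_neg this]
            exact h.first r)
          (fun r hz => by
            have : r = .idx := by simpa [hcmd'] using hz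
            subst this
            simp [hcmd'])
        refine ⟨C', hp, ?_⟩
        simp only [Scan.next, if_neg hb]
        refine ⟨Pos.next_le hq, ?_⟩
        simp only [hcmd', Bool.false_and, Bool.or_false] at hC'
        convert hC' using 1
        · funext j
          simp [hr]
        · have : q.next.row = true := by simp [Pos.next, he, hr]
          simp only [scanMode, this, hcode]
        · funext r
          cases r
          · simp [regs, Pos.next, he, hr]
          · simp [regs, Pos.next, he, hr]
          · simp [regs]
          · simp [regs, hcode]
    · rw [if_neg (by simpa using he)] at hcmd'
      have hcode : q.next.code = q.code + 1 := by
        simp only [Pos.next, Pos.code, if_neg he]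
        omega
      obtain ⟨C', hp, hC'⟩ := exists_path_of_issue
        (v := regs q c) hs h.head h.sheet htable (fun r _ => h.first r)
        (fun r hz => by simp [hcmd'] at hz)
      refine ⟨C', hp, ?_⟩
      simp only [Scan.next, if_neg hb]
      refine ⟨Pos.next_le hq, ?_⟩
      simp only [hcmd', Bool.false_and, Bool.or_false, succ_mod_width] at hC'
      convert hC' using 1
      · funext j
        simp [he]
      · have : q.next.row = q.row := by simp [Pos.next, he]
        simp only [scanMode, this, hcode]
      · funext r
        cases r
        · simp [regs, Pos.next, he]
        · simp [regs, Pos.next, he]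
        · simp [regs]
        · simp only [regs, hcode, ← succ_div_width]
          simp

/-- Inspecting pairs goes on for `ω` rounds. -/
theorem exists_seq_scan {x : CantorReal} {D : ℕ → Bool} {init : Bool} {σ : Scan}
    {C : BlockConfig Walk Track} (h : Scanning x D init σ C) :
    ∃ S : ℕ → BlockConfig Walk Track, S 0 = C ∧ (∀ t, program.Path (conf (S t)) (conf (S (t + 1)))) ∧
      ∀ t, Scanning x D init ((Scan.next x D init)^[t] σ) (S t) := by
  choose f hf using fun (σ : Scan) (C : BlockConfig Walk Track) (h : Scanning x D init σ C) =>
    exists_path_scan h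
  let T : (t : ℕ) → {C // Scanning x D init ((Scan.next x D init)^[t] σ) C} := fun t =>
    Nat.rec ⟨C, h⟩ (fun t C => ⟨f _ C.1 C.2, by
      rw [Function.iterate_succ_apply']; exact (hf _ C.1 C.2).2⟩) t
  exact ⟨fun t => (T t).1, rfl, fun t => (hf _ (T t).1 (T t).2).1, fun t => (T t).2⟩

end Counting

end ITTM

/-! ### The search for a good candidate -/

namespace ITTM

theorem Program.run_of_path {p : Program} {x : CantorReal} {a : Ordinal.{0}}
    {c c' : Config p.numStates} (h₀ : p.run x a = c) (h : p.Path c c') :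
    ∃ k : ℕ, p.run x (a + k) = c' ∧ ∀ b, a ≤ b → b < a + k → (p.run x b).state ≠ State.halt ∧
      ∀ t n, (p.run x b).cells t n = c.cells t n ∨ (p.run x b).cells t n = c'.cells t n := by
  obtain ⟨k, -, hk, hbet⟩ := h
  refine ⟨k, by rw [run_add_nat, h₀, hk], fun b hab hb => ?_⟩
  obtain ⟨m, rfl⟩ := exists_nat_of_lt_add_omega hab
    (hb.trans ((add_lt_add_iff_left a).2 (Ordinal.natCast_lt_omega0 k)))
  have hm : m < k := by
    have := (add_lt_add_iff_left a).1 hb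
    exact_mod_cast this
  rw [run_add_nat, h₀]
  exact hbet m hm

namespace Counting

/-- The blocks on the tapes at a stage of the computation. -/
noncomputable def rowsAt (x : CantorReal) (b : Ordinal.{0}) : ℕ → Block Track :=
  fun j t k => (program.run x b).cells t (j * width + place k)

theorem rowsAt_eq {x : CantorReal} {b : Ordinal.{0}} {C : BlockConfig Walk Track}
    (h : program.run x b = conf C) : rowsAt x b = C.rows := by
  funext j t k
  rw [rowsAt, h]
  exact BlockMachine.flatten_row place C.rows t j k

theorem run_eq_conf {x : CantorReal} {b : Ordinal.{0}}
    (hs : (program.run x b).state = State.limit) (hh : (program.run x b).head = 0) :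
    program.run x b = conf ⟨.limit, 0, rowsAt x b⟩ := by
  have hc : (program.run x b).cells = BlockMachine.flatten place (rowsAt x b) := by
    funext t n
    obtain ⟨j, k, rfl⟩ := BlockMachine.exists_row_eq place n
    rw [BlockMachine.flatten_row]
    rfl
  generalize hr : program.run x b = c at hs hh hc
  obtain ⟨s, h, c⟩ := c
  simp only at hs hh hc
  subst hs hh hc
  simp [conf, BlockMachine.toConfig, BlockMachine.toState]

theorem rowsAt_between {x : CantorReal} {b : Ordinal.{0}} {C C' : BlockConfig Walk Track}
    (h : ∀ t n, (program.run x b).cells t n = (conf C).cells t n ∨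
      (program.run x b).cells t n = (conf C').cells t n) (j : ℕ) (t : Tape) (k : Track) :
    rowsAt x b j t k = C.rows j t k ∨ rowsAt x b j t k = C'.rows j t k := by
  have := h t (j * width + place k)
  rwa [show (conf C).cells t (j * width + place k) = C.rows j t k from
      BlockMachine.flatten_row place C.rows t j k,
    show (conf C').cells t (j * width + place k) = C'.rows j t k from
      BlockMachine.flatten_row place C'.rows t j k] at this

/-- The tapes with marked first block. -/
structure Page (x : CantorReal) (F D : ℕ → Bool) (R : ℕ → Block Track) : Prop where
  sheet : Sheet x F D R
  home : R 0 .scratch .home = true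

theorem Scanning.page {x : CantorReal} {D : ℕ → Bool} {init : Bool} {σ : Scan}
    {C : BlockConfig Walk Track} (h : Scanning x D init σ C) : Page x σ.F D C.rows :=
  ⟨h.2.sheet, h.2.home⟩

theorem Page.between {x : CantorReal} {F D D' : ℕ → Bool} {R R' S : ℕ → Block Track}
    (h : Page x F D R) (h' : Page x F D' R') (hD : ∀ n, D n = true → D' n = true)
    (hS : ∀ j t k, S j t k = R j t k ∨ S j t k = R' j t k) :
    ∃ E : ℕ → Bool, Page x F E S ∧ (∀ n, D n = true → E n = true) ∧ ∀ n, E n = true → D' n = true := by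
  refine ⟨fun j => S j .scratch .del,
    ⟨⟨fun j k => ?_, fun j k => ?_, fun j => ?_, fun j => ?_, fun j => rfl⟩, ?_⟩,
    fun n hn => ?_, fun n hn => ?_⟩
  · rcases hS j .input k with e | e <;> rw [e]
    exacts [h.sheet.input j k, h'.sheet.input j k]
  · rcases hS j .output k with e | e <;> rw [e]
    exacts [h.sheet.output j k, h'.sheet.output j k]
  · rcases hS (j + 1) .scratch .home with e | e <;> rw [e]
    exacts [h.sheet.home j, h'.sheet.home j]
  · rcases hS j .scratch .diag with e | e <;> rw [e]
    exacts [h.sheet.diag j, h'.sheet.diag j]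
  · rcases hS 0 .scratch .home with e | e <;> rw [e]
    exacts [h.home, h'.home]
  · simp only
    rcases hS n .scratch .del with e | e <;> rw [e]
    exacts [(h.sheet.del n).trans hn, (h'.sheet.del n).trans (hD n hn)]
  · simp only at hn
    rcases hS n .scratch .del with e | e <;> rw [e] at hn
    exacts [hD n ((h.sheet.del n).symm.trans hn), (h'.sheet.del n).symm.trans hn]

/-- No place speaks against the candidate `c`. -/
def Good (x : CantorReal) (F D : ℕ → Bool) (c : ℕ) : Prop :=
  ∀ q : Pos, q.i ≤ q.s → bad x F D q c = false

section Scan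

variable {x : CantorReal} {F D : ℕ → Bool}

theorem Scan.next_of_bad {σ : Scan} (h : bad x σ.F D σ.q σ.c = true) :
    σ.next x D false = ⟨σ.F, Pos.first, σ.c + 1, false, true, σ.l || !D σ.c⟩ := by
  simp [Scan.next, h]

theorem Scan.next_of_not_bad {σ : Scan} (h : bad x σ.F D σ.q σ.c = false) :
    σ.next x D false = ⟨σ.F, σ.q.next, σ.c, false, false, σ.l || !D σ.c⟩ := by
  simp [Scan.next, h]

theorem Scan.iterate_F (σ : Scan) (t : ℕ) : ((Scan.next x D false)^[t] σ).F = σ.F := by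
  induction t with
  | zero => rfl
  | succ t ih =>
    rw [Function.iterate_succ_apply', ← ih]
    cases h : bad x ((Scan.next x D false)^[t] σ).F D ((Scan.next x D false)^[t] σ).q
      ((Scan.next x D false)^[t] σ).c
    · rw [next_of_not_bad h]
    · rw [next_of_bad h]

theorem Scan.next_l (σ : Scan) (init : Bool) : (σ.next x D init).l = (σ.l || !D σ.c) := by
  unfold Scan.next
  split_ifs <;> rfl

theorem Scan.next_g (σ : Scan) (init : Bool) : (σ.next x D init).g = init := by
  unfold Scan.next
  split_ifs <;> rfl

theorem Scan.iterate_c_le (σ : Scan) (t : ℕ) :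
    ((Scan.next x D false)^[t] σ).c ≤ σ.c + t := by
  induction t with
  | zero => exact le_rfl
  | succ t ih =>
    rw [Function.iterate_succ_apply']
    cases h : bad x ((Scan.next x D false)^[t] σ).F D ((Scan.next x D false)^[t] σ).q
      ((Scan.next x D false)^[t] σ).c
    · rw [next_of_not_bad h]; simp only; omega
    · rw [next_of_bad h]; simp only; omega

theorem Scan.iterate_l {σ : Scan} {t s : ℕ} (hts : t ≤ s)
    (h : ((Scan.next x D false)^[t] σ).l = true) : ((Scan.next x D false)^[s] σ).l = true := by
  induction s, hts using Nat.le_induction with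
  | base => exact h
  | succ s _ ih => rw [Function.iterate_succ_apply', next_l, ih]; rfl

theorem Scan.exists_of_iterate_l {σ : Scan} (hσ : σ.l = false) {t : ℕ}
    (h : ((Scan.next x D false)^[t] σ).l = true) : ∃ c, D c = false := by
  induction t with
  | zero =>
    rw [Function.iterate_zero_apply, hσ] at h
    cases h
  | succ t ih =>
    rw [Function.iterate_succ_apply', next_l] at h
    rcases Bool.or_eq_true_iff.1 h with h | h
    · exact ih h
    · exact ⟨_, by simpa using h⟩

/-- As long as nothing speaks against the candidate, the places are gone through. -/
theorem Scan.iterate_of_not_bad {σ : Scan} (hq : σ.q = Pos.first) {t : ℕ}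
    (h : ∀ i < t, bad x σ.F D (Pos.next^[i] Pos.first) σ.c = false) :
    ((Scan.next x D false)^[t] σ).q = Pos.next^[t] Pos.first ∧
      ((Scan.next x D false)^[t] σ).c = σ.c ∧
      (0 < t → ((Scan.next x D false)^[t] σ).h = false) := by
  induction t with
  | zero => exact ⟨hq, rfl, fun h => absurd h (lt_irrefl _)⟩
  | succ t ih =>
    obtain ⟨h1, h2, -⟩ := ih fun i hi => h i (by omega)
    have hb := h t (by omega)
    rw [← h1, ← h2, ← iterate_F σ t] at hb
    rw [Function.iterate_succ_apply', next_of_not_bad hb, Function.iterate_succ_apply', h1]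
    exact ⟨rfl, h2, fun _ => rfl⟩

theorem Pos.iterate_next_le (t : ℕ) : (Pos.next^[t] Pos.first).i ≤ (Pos.next^[t] Pos.first).s := by
  induction t with
  | zero => exact le_rfl
  | succ t ih => rw [Function.iterate_succ_apply']; exact Pos.next_le ih

theorem Scan.exists_next_candidate {σ : Scan} (hq : σ.q = Pos.first) (h : ¬ Good x σ.F D σ.c) :
    ∃ t, 0 < t ∧ ((Scan.next x D false)^[t] σ).q = Pos.first ∧
      ((Scan.next x D false)^[t] σ).c = σ.c + 1 ∧ ((Scan.next x D false)^[t] σ).h = true := by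
  have hex : ∃ t, bad x σ.F D (Pos.next^[t] Pos.first) σ.c = true := by
    by_contra hcon
    push Not at hcon
    refine h fun q hq => ?_
    obtain ⟨t, rfl⟩ := q.exists_iterate_next hq
    simpa using hcon t
  classical
  obtain ⟨t, hb, hmin⟩ : ∃ t, bad x σ.F D (Pos.next^[t] Pos.first) σ.c = true ∧
      ∀ i < t, bad x σ.F D (Pos.next^[i] Pos.first) σ.c = false :=
    ⟨Nat.find hex, Nat.find_spec hex, fun i hi => by simpa using Nat.find_min hex hi⟩
  obtain ⟨h1, h2, -⟩ := iterate_of_not_bad (x := x) (D := D) hq hmin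
  rw [← h1, ← h2, ← iterate_F σ t] at hb
  refine ⟨t + 1, by omega, ?_⟩
  rw [Function.iterate_succ_apply', next_of_bad hb]
  exact ⟨rfl, by rw [h2], rfl⟩

theorem Scan.exists_candidate {σ : Scan} (hq : σ.q = Pos.first) (hc : σ.c = 0) (c : ℕ)
    (h : ∀ c' < c, ¬ Good x σ.F D c') :
    ∃ t, ((Scan.next x D false)^[t] σ).q = Pos.first ∧ ((Scan.next x D false)^[t] σ).c = c ∧
      (0 < c → ((Scan.next x D false)^[t] σ).h = true) := by
  induction c with
  | zero => exact ⟨0, hq, hc, fun h => absurd h (lt_irrefl _)⟩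
  | succ c ih =>
    obtain ⟨t, h1, h2, -⟩ := ih fun c' hc' => h c' (by omega)
    obtain ⟨s, -, h3, h4, h5⟩ := exists_next_candidate (x := x) (D := D) h1
      (by rw [iterate_F, h2]; exact h c (by omega))
    rw [← Function.iterate_add_apply] at h3 h4 h5
    exact ⟨s + t, h3, by rw [h4, h2], fun _ => h5⟩

/-- If there is a good candidate, then the search ends with one. -/
theorem Scan.exists_forall_c_eq {σ : Scan} (hq : σ.q = Pos.first) (hc : σ.c = 0)
    (h : ∃ c, Good x σ.F D c) :
    ∃ c T, Good x σ.F D c ∧ ∀ t ≥ T, ((Scan.next x D false)^[t] σ).c = c ∧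
      ((Scan.next x D false)^[t] σ).h = false := by
  classical
  obtain ⟨T, h1, h2, -⟩ := exists_candidate (x := x) (D := D) hq hc (Nat.find h)
    fun c' hc' => Nat.find_min h hc'
  refine ⟨Nat.find h, T + 1, Nat.find_spec h, fun t ht => ?_⟩
  obtain ⟨s, rfl⟩ := Nat.exists_eq_add_of_le' ht
  obtain ⟨-, h3, h4⟩ := iterate_of_not_bad (x := x) (D := D) h1 (t := s + 1) fun i _ => by
    rw [h2, iterate_F]
    exact Nat.find_spec h _ (Pos.iterate_next_le i)
  rw [← Function.iterate_add_apply] at h3 h4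
  rw [show s + (T + 1) = s + 1 + T by omega]
  exact ⟨h3.trans h2, h4 (by omega)⟩

/-- If there is no good candidate, then the candidate changes again and again. -/
theorem Scan.frequently_h {σ : Scan} (hq : σ.q = Pos.first) (hc : σ.c = 0)
    (h : ∀ c, ¬ Good x σ.F D c) : ∃ᶠ t in atTop, ((Scan.next x D false)^[t] σ).h = true := by
  rw [frequently_atTop]
  intro N
  obtain ⟨t, -, h2, h3⟩ := exists_candidate (x := x) (D := D) hq hc (N + 1) fun c _ => h c
  have := iterate_c_le (x := x) (D := D) σ t
  exact ⟨t, by omega, h3 (by omega)⟩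

theorem Scan.frequently_l {σ : Scan} (hq : σ.q = Pos.first) (hc : σ.c = 0) (hl : σ.l = false)
    (h : ∀ c, ¬ Good x σ.F D c) :
    (∃ᶠ t in atTop, ((Scan.next x D false)^[t] σ).l = true) ↔ ∃ c, D c = false := by
  constructor
  · intro hf
    obtain ⟨t, ht⟩ := hf.exists
    exact exists_of_iterate_l hl ht
  · rintro ⟨c, hD⟩
    obtain ⟨t, -, h2, -⟩ := exists_candidate (x := x) (D := D) hq hc c fun c _ => h c
    have h3 : ((Scan.next x D false)^[t + 1] σ).l = true := by
      rw [Function.iterate_succ_apply', next_l, h2, hD]; simp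
    exact Eventually.frequently (eventually_atTop.2 ⟨t + 1, fun s hs => iterate_l hs h3⟩)

/-- In the first pass all places are gone through, and the track `diag` is filled. -/
theorem Scan.iterate_init {σ : Scan} (hq : σ.q = Pos.first) (hF : σ.F = fun _ => false)
    (hg : σ.g = true) (t : ℕ) :
    ((Scan.next x D true)^[t] σ).q = Pos.next^[t] Pos.first ∧
      ((Scan.next x D true)^[t] σ).g = true ∧ ∀ j, ((Scan.next x D true)^[t] σ).F j =
        (decide (j < (Pos.next^[t] Pos.first).s) && x (Nat.pair j j)) := by
  induction t with
  | zero => exact ⟨hq, hg, fun j => by simp [hF, Pos.first]⟩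
  | succ t ih =>
    obtain ⟨h1, -, h3⟩ := ih
    rw [Function.iterate_succ_apply', Function.iterate_succ_apply']
    refine ⟨by simp [Scan.next, h1], next_g _ _, fun j => ?_⟩
    simp only [Scan.next, Bool.not_true, Bool.false_and, Bool.false_eq_true, if_false, h3, h1,
      Bool.true_and]
    generalize Pos.next^[t] Pos.first = q
    by_cases he : q.i = q.s
    · cases hr : q.row
      · simp [Pos.next, he, hr]
      · rcases lt_trichotomy j q.s with h | h | h
        · simp [Pos.next, he, hr, h, h.ne, Nat.lt_succ_of_lt h]
        · simp [Pos.next, he, hr, h]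
        · have h1 : ¬ j < q.s := by omega
          have h2 : ¬ j < q.s + 1 := by omega
          simp [Pos.next, he, hr, h1, h2, h.ne']
    · simp [Pos.next, he]

theorem Pos.exists_forall_lt (j : ℕ) : ∃ T, ∀ t ≥ T, j < (Pos.next^[t] Pos.first).s := by
  obtain ⟨T, hT⟩ := (⟨false, 0, j + 1⟩ : Pos).exists_iterate_next (Nat.zero_le _)
  refine ⟨T, fun t ht => ?_⟩
  induction t, ht using Nat.le_induction with
  | base => rw [hT]; simp
  | succ t _ ih =>
    rw [Function.iterate_succ_apply']
    refine lt_of_lt_of_le ih ?_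
    unfold Pos.next
    split_ifs <;> simp

end Scan

section Limit

variable {x : CantorReal} {a : Ordinal.{0}} {S : ℕ → BlockConfig Walk Track}

theorem rowsAt_add_omega (h₀ : program.run x a = conf (S 0))
    (hS : ∀ t, program.Path (conf (S t)) (conf (S (t + 1)))) (j : ℕ) (t : Tape) (k : Track) :
    rowsAt x (a + Ordinal.omega0) j t k = true ↔ ∃ᶠ i in atTop, (S i).rows j t k = true := by
  rw [rowsAt, (Program.run_of_paths h₀ hS).2.2.2.2]
  simp only [show ∀ i, (conf (S i)).cells t (j * width + place k) = (S i).rows j t k from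
    fun i => BlockMachine.flatten_row place (S i).rows t j k]

theorem rowsAt_add_omega_eq (h₀ : program.run x a = conf (S 0))
    (hS : ∀ t, program.Path (conf (S t)) (conf (S (t + 1)))) {j : ℕ} {t : Tape} {k : Track}
    {v : Bool} {T : ℕ} (h : ∀ i ≥ T, (S i).rows j t k = v) :
    rowsAt x (a + Ordinal.omega0) j t k = v := by
  cases v
  · rw [← Bool.not_eq_true, rowsAt_add_omega h₀ hS, not_frequently]
    exact eventually_atTop.2 ⟨T, fun i hi => by simp [h i hi]⟩
  · rw [rowsAt_add_omega h₀ hS]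
    exact (eventually_atTop.2 ⟨T, h⟩).frequently

/-- The content of the tapes at a limit stage reached through stages with the same content. -/
theorem page_add_omega {F D : ℕ → Bool} {G : ℕ → ℕ → Bool} (h₀ : program.run x a = conf (S 0))
    (hS : ∀ t, program.Path (conf (S t)) (conf (S (t + 1)))) (hP : ∀ t, Page x (G t) D (S t).rows)
    (hG : ∀ j, ∃ T, ∀ t ≥ T, G t j = F j) : Page x F D (rowsAt x (a + Ordinal.omega0)) := by
  refine ⟨⟨fun j k => ?_, fun j k => ?_, fun j => ?_, fun j => ?_, fun j => ?_⟩, ?_⟩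
  · exact rowsAt_add_omega_eq h₀ hS (T := 0) fun i _ => (hP i).sheet.input j k
  · exact rowsAt_add_omega_eq h₀ hS (T := 0) fun i _ => (hP i).sheet.output j k
  · exact rowsAt_add_omega_eq h₀ hS (T := 0) fun i _ => (hP i).sheet.home j
  · obtain ⟨T, hT⟩ := hG j
    exact rowsAt_add_omega_eq h₀ hS (T := T) fun i hi => ((hP i).sheet.diag j).trans (hT i hi)
  · exact rowsAt_add_omega_eq h₀ hS (T := 0) fun i _ => (hP i).sheet.del j
  · exact rowsAt_add_omega_eq h₀ hS (T := 0) fun i _ => (hP i).home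

end Limit

/-- The stage is a limit stage at which the machine is in the limit state on the first cell. -/
def AtLimit (x : CantorReal) (a : Ordinal.{0}) : Prop :=
  program.run x a = conf ⟨.limit, 0, rowsAt x a⟩

/-- At the limit a good candidate has been found. -/
def Found (x : CantorReal) (F D : ℕ → Bool) (R : ℕ → Block Track) (c : ℕ) : Prop :=
  R 0 .scratch .fresh = false ∧ R 0 .scratch .moved = false ∧ Good x F D c ∧
    IsFirst (fun j => R j .scratch (.mark .cand)) c

/-- At the limit there is no good candidate. -/
def Final (x : CantorReal) (F D : ℕ → Bool) (R : ℕ → Block Track) : Prop :=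
  R 0 .scratch .fresh = false ∧ R 0 .scratch .moved = true ∧ (∀ c, ¬ Good x F D c) ∧
    (R 0 .scratch .left = true ↔ ∃ c, D c = false)

/-- The search for a good candidate. -/
theorem search {x : CantorReal} {F D : ℕ → Bool} {a : Ordinal.{0}} {C : BlockConfig Walk Track}
    {g h : Bool} (h₀ : program.run x a = conf C)
    (hC : Scanning x D false ⟨F, Pos.first, 0, g, h, false⟩ C) :
    (∀ b, a ≤ b → b < a + Ordinal.omega0 →
      (program.run x b).state ≠ State.halt ∧ ∃ E : ℕ → Bool, Page x F E (rowsAt x b) ∧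
        (∀ n, D n = true → E n = true) ∧ ∀ n, E n = true → D n = true) ∧
    AtLimit x (a + Ordinal.omega0) ∧ Page x F D (rowsAt x (a + Ordinal.omega0)) ∧
    ((∃ c, Found x F D (rowsAt x (a + Ordinal.omega0)) c) ∨
      Final x F D (rowsAt x (a + Ordinal.omega0))) := by
  obtain ⟨S, rfl, hS, hscan⟩ := exists_seq_scan hC
  have hP : ∀ t, Page x F D (S t).rows := fun t => by
    have := (hscan t).page
    rwa [Scan.iterate_F] at this
  obtain ⟨h1, h2, h3, h4, h5⟩ := Program.run_of_paths h₀ hS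
  refine ⟨fun b hab hb => ⟨(h1 b hab hb).1, ?_⟩, run_eq_conf h3 h4,
    page_add_omega h₀ hS hP fun j => ⟨0, fun _ _ => rfl⟩, ?_⟩
  · obtain ⟨i, hi⟩ := (h1 b hab hb).2
    exact (hP i).between (hP (i + 1)) (fun n hn => hn) (rowsAt_between hi)
  · have hfresh : rowsAt x (a + Ordinal.omega0) 0 .scratch .fresh = false := by
      refine rowsAt_add_omega_eq h₀ hS (T := 1) fun i hi => ?_
      obtain ⟨i, rfl⟩ := Nat.exists_eq_add_of_le' hi
      rw [(hscan _).2.fresh, Function.iterate_succ_apply', Scan.next_g]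
    by_cases hgood : ∃ c, Good x F D c
    · left
      obtain ⟨c, T, hc, hT⟩ := Scan.exists_forall_c_eq (x := x) (D := D)
        (σ := ⟨F, Pos.first, 0, g, h, false⟩) rfl rfl hgood
      refine ⟨c, hfresh, ?_, hc, ?_, fun j hj => ?_⟩
      · exact rowsAt_add_omega_eq h₀ hS (T := T) fun i hi =>
          ((hscan i).2.moved).trans (hT i hi).2
      · refine rowsAt_add_omega_eq h₀ hS (T := T) fun i hi => ?_
        have := ((hscan i).2.first .cand).1
        simp only [regs] at this
        rwa [(hT i hi).1] at this
      · refine rowsAt_add_omega_eq h₀ hS (T := T) fun i hi => ?_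
        exact ((hscan i).2.first .cand).2 j (by simpa only [regs, (hT i hi).1] using hj)
    · right
      push Not at hgood
      refine ⟨hfresh, ?_, hgood, ?_⟩
      · rw [rowsAt_add_omega h₀ hS]
        simp only [fun i => (hscan i).2.moved]
        exact Scan.frequently_h rfl rfl hgood
      · rw [rowsAt_add_omega h₀ hS]
        simp only [fun i => (hscan i).2.left]
        exact Scan.frequently_l rfl rfl rfl hgood

/-- The first pass. -/
theorem first_pass {x : CantorReal} {D : ℕ → Bool} {a : Ordinal.{0}} {C : BlockConfig Walk Track}
    {c : ℕ} {h l : Bool} (h₀ : program.run x a = conf C)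
    (hC : Scanning x D true ⟨fun _ => false, Pos.first, c, true, h, l⟩ C) :
    (∀ b, a ≤ b → b < a + Ordinal.omega0 → (program.run x b).state ≠ State.halt) ∧
    AtLimit x (a + Ordinal.omega0) ∧
    Page x (fun n => x (Nat.pair n n)) D (rowsAt x (a + Ordinal.omega0)) ∧
    rowsAt x (a + Ordinal.omega0) 0 .scratch .fresh = true := by
  obtain ⟨S, rfl, hS, hscan⟩ := exists_seq_scan hC
  have hit := Scan.iterate_init (x := x) (D := D)
    (σ := ⟨fun _ => false, Pos.first, c, true, h, l⟩) rfl rfl rfl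
  obtain ⟨h1, h2, h3, h4, h5⟩ := Program.run_of_paths h₀ hS
  refine ⟨fun b hab hb => (h1 b hab hb).1, run_eq_conf h3 h4,
    page_add_omega h₀ hS (fun t => (hscan t).page) fun j => ?_, ?_⟩
  · obtain ⟨T, hT⟩ := Pos.exists_forall_lt j
    exact ⟨T, fun t ht => by rw [(hit t).2.2, decide_eq_true (hT t ht), Bool.true_and]⟩
  · exact rowsAt_add_omega_eq h₀ hS (T := 0) fun i _ => ((hscan i).2.fresh).trans (hit i).2.1

end Counting

end ITTM

/-! ### Segments between limit stages -/

namespace ITTM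

namespace Counting

/-- The set of all `n` with `n ◁ n`, the field of a reflexive relation. -/
def diagonal (x : CantorReal) (n : ℕ) : Bool := x (Nat.pair n n)

/-- What happens from a limit stage `a` to the next one, when `D` has been deleted before and `D'`
after it. -/
structure Segment (x : CantorReal) (D D' : ℕ → Bool) (a : Ordinal.{0}) : Prop where
  between : ∀ b, a ≤ b → b < a + Ordinal.omega0 →
    (program.run x b).state ≠ State.halt ∧ ∃ E : ℕ → Bool, Page x (diagonal x) E (rowsAt x b) ∧
      (∀ n, D n = true → E n = true) ∧ ∀ n, E n = true → D' n = true
  atLimit : AtLimit x (a + Ordinal.omega0)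
  page : Page x (diagonal x) D' (rowsAt x (a + Ordinal.omega0))
  result : (∃ c, Found x (diagonal x) D' (rowsAt x (a + Ordinal.omega0)) c) ∨
    Final x (diagonal x) D' (rowsAt x (a + Ordinal.omega0))

theorem add_nat_add_omega (a : Ordinal.{0}) (k : ℕ) :
    a + k + Ordinal.omega0 = a + Ordinal.omega0 := by
  rw [add_assoc, Ordinal.natCast_add_omega0]

/-- A segment may begin with a path. -/
theorem Segment.of_path {x : CantorReal} {D D' : ℕ → Bool} {a : Ordinal.{0}} {k : ℕ}
    {C C' : BlockConfig Walk Track} (hC : Page x (diagonal x) D C.rows)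
    (hC' : Page x (diagonal x) D' C'.rows) (hD : ∀ n, D n = true → D' n = true)
    (hk : ∀ b, a ≤ b → b < a + k → (program.run x b).state ≠ State.halt ∧
      ∀ t n, (program.run x b).cells t n = (conf C).cells t n ∨
        (program.run x b).cells t n = (conf C').cells t n)
    (h : Segment x D' D' (a + k)) : Segment x D D' a := by
  obtain ⟨h1, h2, h3, h4⟩ := h
  rw [add_nat_add_omega] at h1 h2 h3 h4
  refine ⟨fun b hab hb => ?_, h2, h3, h4⟩
  rcases lt_or_ge b (a + k) with hbk | hbk
  · exact ⟨(hk b hab hbk).1, hC.between hC' hD (rowsAt_between (hk b hab hbk).2)⟩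
  · obtain ⟨h5, E, h6, h7, h8⟩ := h1 b hbk hb
    exact ⟨h5, E, h6, fun n hn => h7 n (hD n hn), h8⟩

theorem scanMode_first (init : Bool) : scanMode init Pos.first = .scan init false 0 := by
  simp only [scanMode, Pos.first, Mode.scan.injEq, true_and]
  ext
  simp [Pos.code]

theorem regs_first : regs Pos.first 0 = fun _ => 0 := by
  funext r
  cases r <;> simp [regs, Pos.first, Pos.code]

/-- The segment after a restart. -/
theorem segment_of_restart {x : CantorReal} {D : ℕ → Bool} {a : Ordinal.{0}}
    {C : BlockConfig Walk Track} (h₀ : program.run x a = conf C) (hs : C.state ≠ .halt)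
    (hh : C.head = 0) (hP : Page x (diagonal x) D C.rows)
    (hc : machine.table C.state (C.rows 0) = issue restartCmd (C.rows 0)) : Segment x D D a := by
  obtain ⟨C', hp, hC'⟩ := exists_path_of_issue (v := fun _ => 0) hs hh hP.sheet hc
    (fun r hr => by simp [restartCmd] at hr) (fun r _ => ⟨rfl, rfl⟩)
  have hscan : Scanning x D false ⟨diagonal x, Pos.first, 0, false, false, false⟩ C' := by
    refine ⟨le_rfl, ?_⟩
    rw [scanMode_first, regs_first]
    simpa [restartCmd] using hC'
  obtain ⟨k, hk, hbet⟩ := Program.run_of_path h₀ hp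
  obtain ⟨h1, h2, h3, h4⟩ := search hk hscan
  exact Segment.of_path hP hscan.page (fun _ hn => hn) hbet ⟨h1, h2, h3, h4⟩

/-- The segment from a limit of limit stages, or from the end of the first pass. -/
theorem segment_of_fresh {x : CantorReal} {D : ℕ → Bool} {a : Ordinal.{0}} (h₀ : AtLimit x a)
    (hP : Page x (diagonal x) D (rowsAt x a)) (hf : rowsAt x a 0 .scratch .fresh = true) :
    Segment x D D a := by
  refine segment_of_restart h₀ nofun rfl hP ?_
  simp only [machine, hf, if_true]

/-- The segment in which a good candidate is deleted. -/
theorem segment_of_found {x : CantorReal} {D : ℕ → Bool} {a : Ordinal.{0}} {c : ℕ}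
    (h₀ : AtLimit x a) (hP : Page x (diagonal x) D (rowsAt x a))
    (hf : Found x (diagonal x) D (rowsAt x a) c) :
    Segment x D (fun n => D n || decide (n = c)) a ∧
      ∃ b, a ≤ b ∧ b < a + Ordinal.omega0 ∧ rowsAt x b 0 .scratch .fresh = true := by
  obtain ⟨hf1, hf2, -, hfc⟩ := hf
  obtain ⟨C', hp, hC'⟩ := exists_path_of_issue (c := eraseCmd) (C := ⟨.limit, 0, rowsAt x a⟩)
    (v := fun r => if r = .cand then c else 0)
    (show (Ctrl.limit : Ctrl Walk) ≠ .halt from nofun) rfl hP.sheet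
    (by simp only [machine, hf1, hf2, if_false, Bool.false_eq_true])
    (fun r hr => by
      have : r = .cand := by simpa [eraseCmd] using hr
      subst this
      simpa using hfc)
    (fun r hr => by
      have : r ≠ .cand := by simpa [eraseCmd] using hr
      exact ⟨if_neg this, rfl⟩)
  simp only [eraseCmd, Bool.false_and, Bool.or_false, Bool.true_and, if_true] at hC'
  obtain ⟨k, hk, hbet⟩ := Program.run_of_path h₀ hp
  have hP' : Page x (diagonal x) (fun n => D n || decide (n = c)) C'.rows := ⟨hC'.sheet, hC'.home⟩
  obtain ⟨mem, hstate, -⟩ := hC'.state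
  refine ⟨Segment.of_path hP hP' (fun n hn => by simp [hn]) hbet
    (segment_of_restart hk (by rw [hstate]; exact nofun) hC'.head hP' ?_),
    a + k, le_self_add, (add_lt_add_iff_left a).2 (Ordinal.natCast_lt_omega0 k), ?_⟩
  · simp only [hstate, machine, hC'.home, if_true, nextCmd]
  · rw [rowsAt_eq hk]; exact hC'.fresh

/-- The first `ω` stages. -/
theorem run_omega (x : CantorReal) :
    (∀ b, b < Ordinal.omega0 → (program.run x b).state ≠ State.halt) ∧ AtLimit x Ordinal.omega0 ∧
    Page x (diagonal x) (fun _ => false) (rowsAt x Ordinal.omega0) ∧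
    rowsAt x Ordinal.omega0 0 .scratch .fresh = true := by
  have hinit : program.run x 0 = conf ⟨.start, 0, rowsAt x 0⟩ := by
    have hc : (program.run x 0).cells = BlockMachine.flatten place (rowsAt x 0) := by
      funext t n
      obtain ⟨j, k, rfl⟩ := BlockMachine.exists_row_eq place n
      rw [BlockMachine.flatten_row]
      rfl
    simp only [conf, BlockMachine.toConfig, BlockMachine.toState, Nat.zero_mul, ← hc]
    rw [Program.run_zero]
    rfl
  have hin : ∀ j k, rowsAt x 0 j .input k = x (j * width + place k) := fun j k => by
    rw [rowsAt, Program.run_zero]; rfl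
  have hscr : ∀ j k, rowsAt x 0 j .scratch k = false := fun j k => by
    rw [rowsAt, Program.run_zero]; rfl
  have hout : ∀ j k, rowsAt x 0 j .output k = false := fun j k => by
    rw [rowsAt, Program.run_zero]; rfl
  have hS : Sheet x (fun _ => false) (fun _ => false) (rowsAt x 0) :=
    ⟨hin, hout, fun _ => hscr _ _, fun _ => hscr _ _, fun _ => hscr _ _⟩
  obtain ⟨C', hp, hC'⟩ := exists_path_of_issue (c := startCmd) (C := ⟨.start, 0, rowsAt x 0⟩)
    (v := fun _ => 0) nofun rfl hS rfl (fun r hr => by simp [startCmd] at hr) (fun r _ => ⟨rfl, rfl⟩)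
  have hscan : Scanning x (fun _ => false) true
      ⟨fun _ => false, Pos.first, 0, true, false, false⟩ C' := by
    refine ⟨le_rfl, ?_⟩
    rw [scanMode_first, regs_first]
    simpa [startCmd] using hC'
  obtain ⟨k, hk, hbet⟩ := Program.run_of_path hinit hp
  obtain ⟨h1, h2, h3, h4⟩ := first_pass hk hscan
  rw [add_nat_add_omega] at h1 h2 h3 h4
  simp only [zero_add] at h1 h2 h3 h4 hbet
  refine ⟨fun b hb => ?_, h2, h3, h4⟩
  rcases lt_or_ge b k with hbk | hbk
  · exact (hbet b zero_le hbk).1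
  · exact h1 b hbk hb

/-- The numbers that have been deleted at stage `ω * β`. -/
noncomputable def deleted (x : CantorReal) (β : Ordinal.{0}) (n : ℕ) : Bool :=
  rowsAt x (Ordinal.omega0 * β) n .scratch .del

/-- The search for a further number to delete has failed at stage `ω * β`. -/
def FinalAt (x : CantorReal) (β : Ordinal.{0}) : Prop :=
  Final x (diagonal x) (deleted x β) (rowsAt x (Ordinal.omega0 * β))

/-- What holds at stage `ω * β`, for `1 ≤ β`, up to the first one at which the search has failed. -/
structure Inv (x : CantorReal) (β : Ordinal.{0}) : Prop where
  atLimit : AtLimit x (Ordinal.omega0 * β)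
  page : Page x (diagonal x) (deleted x β) (rowsAt x (Ordinal.omega0 * β))
  kind : rowsAt x (Ordinal.omega0 * β) 0 .scratch .fresh = true ∨
    (∃ c, Found x (diagonal x) (deleted x β) (rowsAt x (Ordinal.omega0 * β)) c) ∨ FinalAt x β

theorem deleted_eq {x : CantorReal} {β : Ordinal.{0}} {F D : ℕ → Bool}
    (h : Page x F D (rowsAt x (Ordinal.omega0 * β))) : deleted x β = D :=
  funext h.sheet.del

/-- One segment. -/
theorem Inv.next {x : CantorReal} {β : Ordinal.{0}} (h : Inv x β) (hf : ¬ FinalAt x β) :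
    Segment x (deleted x β) (deleted x (β + 1)) (Ordinal.omega0 * β) ∧
    Inv x (β + 1) ∧
    (deleted x (β + 1) = deleted x β ∨ ∃ c, Good x (diagonal x) (deleted x β) c ∧
      deleted x (β + 1) = fun n => deleted x β n || decide (n = c)) ∧
    ((∃ c, Found x (diagonal x) (deleted x (β + 1)) (rowsAt x (Ordinal.omega0 * (β + 1))) c) ∨
      FinalAt x (β + 1)) ∧
    (∀ c, Found x (diagonal x) (deleted x β) (rowsAt x (Ordinal.omega0 * β)) c →
      (∃ b, Ordinal.omega0 * β ≤ b ∧ b < Ordinal.omega0 * (β + 1) ∧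
        rowsAt x b 0 .scratch .fresh = true) ∧ deleted x (β + 1) c = true) := by
  have hmul : Ordinal.omega0 * (β + 1) = Ordinal.omega0 * β + Ordinal.omega0 := mul_add_one _ _
  have key : ∀ D', Segment x (deleted x β) D' (Ordinal.omega0 * β) →
      deleted x (β + 1) = D' ∧ Segment x (deleted x β) (deleted x (β + 1)) (Ordinal.omega0 * β) ∧
      Inv x (β + 1) ∧
      ((∃ c, Found x (diagonal x) (deleted x (β + 1)) (rowsAt x (Ordinal.omega0 * (β + 1))) c) ∨
        FinalAt x (β + 1)) := by
    intro D' hs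
    have hD : deleted x (β + 1) = D' := deleted_eq (hmul ▸ hs.page)
    subst hD
    have hr := hs.result
    rw [← hmul] at hr
    exact ⟨rfl, hs, ⟨hmul ▸ hs.atLimit, hmul ▸ hs.page, Or.inr hr⟩, hr⟩
  by_cases hfresh : rowsAt x (Ordinal.omega0 * β) 0 .scratch .fresh = true
  · obtain ⟨h1, h2, h3, h4⟩ := key _ (segment_of_fresh h.atLimit h.page hfresh)
    refine ⟨h2, h3, Or.inl h1, h4, fun c hc => ?_⟩
    rw [hc.1] at hfresh
    cases hfresh
  · have hex : ∃ c, Found x (diagonal x) (deleted x β) (rowsAt x (Ordinal.omega0 * β)) c := by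
      rcases h.kind with h | h | h
      exacts [absurd h hfresh, h, absurd h hf]
    obtain ⟨c, hc⟩ := hex
    obtain ⟨h1, h2, h3, h4⟩ := key _ (segment_of_found h.atLimit h.page hc).1
    refine ⟨h2, h3, Or.inr ⟨c, hc.2.2.1, h1⟩, h4, fun c' hc' => ?_⟩
    obtain ⟨hs, hb⟩ := segment_of_found h.atLimit h.page hc'
    rw [← hmul] at hb
    exact ⟨hb, by rw [(key _ hs).1]; simp⟩

/-- Everything the deletion of numbers is to guarantee: a deleted number is related to numbers of
the field only, and to none in both directions, and a subset of the field of which something has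
been deleted has a least element. -/
structure Sound (x : CantorReal) (D : ℕ → Bool) : Prop where
  field : ∀ n, D n = true → ∀ m, (codedRel x n m ∨ codedRel x m n) →
    codedRel x n n ∧ codedRel x m m
  antisymm : ∀ n, D n = true → ∀ m, codedRel x n m → codedRel x m n → n = m
  least : ∀ S : Set ℕ, (∀ n ∈ S, codedRel x n n) → (∃ n ∈ S, D n = true) →
    ∃ n ∈ S, ∀ k ∈ S, codedRel x n k

/-- The meaning of a good candidate: if it belongs to the field at all, it is the least remaining
element. -/
theorem good_iff {x : CantorReal} {D : ℕ → Bool} {c : ℕ} :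
    Good x (diagonal x) D c ↔ D c = false ∧ ∀ m,
      (codedRel x c m ∨ codedRel x m c → codedRel x c c ∧ codedRel x m m) ∧
      (codedRel x c c → codedRel x m m → D m = false →
        codedRel x c m ∧ (m ≠ c → ¬ codedRel x m c)) := by
  unfold codedRel
  constructor
  · intro h
    have hD : D c = false := by
      have := h Pos.first le_rfl
      simp only [bad, Bool.or_eq_false_iff] at this
      exact this.1
    have hpair : ∀ a b, badPair (decide (a = c)) (decide (b = c)) (diagonal x a) (diagonal x b) (D a)
        (D b) (x (Nat.pair a b)) = false := by
      intro a b
      rcases Nat.lt_or_ge a b with hab | hab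
      · have := h ⟨false, a, b⟩ hab.le
        simpa [bad, Pos.fst, Pos.snd, hab.ne, hD] using this
      · have := h ⟨true, b, a⟩ hab
        simpa [bad, Pos.fst, Pos.snd, hD] using this
    refine ⟨hD, fun m => ?_⟩
    have h1 := hpair c m
    have h2 := hpair m c
    unfold badPair diagonal at h1 h2
    by_cases hm : m = c
    · subst hm
      cases hcc : x (Nat.pair m m) <;> simp_all
    · cases hcc : x (Nat.pair c c) <;> cases hmm : x (Nat.pair m m) <;>
        cases hcm : x (Nat.pair c m) <;> cases hmc : x (Nat.pair m c) <;> simp_all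
  · rintro ⟨hD, h⟩ q -
    unfold bad
    rw [hD, Bool.false_or]
    refine Bool.and_eq_false_iff.2 (Or.inr ?_)
    generalize q.fst = a
    generalize q.snd = b
    unfold badPair diagonal
    by_cases ha : a = c
    · subst ha
      have h1 := h b
      have h2 := h a
      cases hcc : x (Nat.pair a a) <;> cases hmm : x (Nat.pair b b) <;>
        cases hcm : x (Nat.pair a b) <;> simp_all
    · by_cases hb : b = c
      · subst hb
        have h1 := h a
        cases hcc : x (Nat.pair a a) <;> cases hmm : x (Nat.pair b b) <;>
          cases hcm : x (Nat.pair a b) <;> simp_all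
      · simp [ha, hb]

theorem Sound.insert {x : CantorReal} {D : ℕ → Bool} {c : ℕ} (h : Sound x D)
    (hc : Good x (diagonal x) D c) : Sound x fun n => D n || decide (n = c) := by
  obtain ⟨-, hc⟩ := good_iff.1 hc
  refine ⟨fun n hn m hnm => ?_, fun n hn m h1 h2 => ?_, fun S hS hex => ?_⟩
  · rcases Bool.or_eq_true_iff.1 hn with hn | hn
    · exact h.field n hn m hnm
    · rw [of_decide_eq_true hn] at hnm ⊢
      exact (hc m).1 hnm
  · rcases Bool.or_eq_true_iff.1 hn with hn | hn
    · exact h.antisymm n hn m h1 h2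
    · rw [of_decide_eq_true hn] at h1 h2 ⊢
      by_contra hne
      cases hm : D m
      · obtain ⟨h3, h4⟩ := (hc m).1 (Or.inl h1)
        exact ((hc m).2 h3 h4 hm).2 (Ne.symm hne) h2
      · exact hne (h.antisymm m hm c h2 h1).symm
  · by_cases hD : ∃ n ∈ S, D n = true
    · exact h.least S hS hD
    · push Not at hD
      obtain ⟨n, hn, hn'⟩ := hex
      obtain rfl : n = c := by
        rcases Bool.or_eq_true_iff.1 hn' with h | h
        · exact absurd h (hD n hn)
        · exact of_decide_eq_true h
      exact ⟨n, hn, fun k hk => ((hc k).2 (hS n hn) (hS k hk) (by simpa using hD k hk)).1⟩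

theorem Sound.of_forall_exists {x : CantorReal} {D : ℕ → Bool}
    (h : ∀ n, D n = true → ∃ E : ℕ → Bool, Sound x E ∧ E n = true) : Sound x D := by
  refine ⟨fun n hn => ?_, fun n hn => ?_, fun S hS hex => ?_⟩
  · obtain ⟨E, hE, hn⟩ := h n hn
    exact hE.field n hn
  · obtain ⟨E, hE, hn⟩ := h n hn
    exact hE.antisymm n hn
  · obtain ⟨n, hnS, hn⟩ := hex
    obtain ⟨E, hE, hn⟩ := h n hn
    exact hE.least S hS ⟨n, hnS, hn⟩

theorem codesWellOrder_of_sound {x : CantorReal} {D : ℕ → Bool} (h : Sound x D)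
    (hD : ∀ n, D n = true) : CodesWellOrder x := by
  have hfield : ∀ n ∈ codedField x, codedRel x n n := by
    rintro n ⟨k, hk⟩
    exact (h.field n (hD n) k hk).1
  have hanti : ∀ n k, codedRel x n k → codedRel x k n → n = k := fun n k => h.antisymm n (hD n) k
  have hleast : ∀ S : Set ℕ, S ⊆ codedField x → S.Nonempty → ∃ n ∈ S, ∀ k ∈ S, codedRel x n k :=
    fun S hS ⟨n, hn⟩ => h.least S (fun n hn => hfield n (hS hn)) ⟨n, hn, hD n⟩
  refine ⟨hfield, hanti, fun n k r hnk hkr => ?_, fun n hn k hk => ?_, hleast⟩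
  · obtain ⟨m, hm, hle⟩ := hleast {n, k, r}
      (by
        rintro _ (rfl | rfl | rfl)
        exacts [⟨k, Or.inl hnk⟩, ⟨n, Or.inr hnk⟩, ⟨k, Or.inr hkr⟩])
      ⟨n, by simp⟩
    have h1 := hle n (by simp)
    have h2 := hle k (by simp)
    have h3 := hle r (by simp)
    rcases hm with rfl | rfl | rfl
    · exact h3
    · rwa [hanti n m hnk h1]
    · rwa [← hanti k m hkr h2]
  · obtain ⟨m, hm, hle⟩ := hleast {n, k} (by rintro _ (rfl | rfl) <;> assumption) ⟨n, by simp⟩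
    rcases hm with rfl | rfl
    · exact Or.inl (hle k (by simp))
    · exact Or.inr (hle n (by simp))

theorem exists_good {x : CantorReal} {D : ℕ → Bool} (hx : CodesWellOrder x) {n : ℕ}
    (hn : D n = false) : ∃ c, Good x (diagonal x) D c := by
  by_cases h : ∃ m, m ∉ codedField x ∧ D m = false
  · obtain ⟨m, hm, hD⟩ := h
    have hm' : ∀ k, ¬ codedRel x m k ∧ ¬ codedRel x k m := fun k =>
      not_or.1 fun hk => hm ⟨k, hk⟩
    exact ⟨m, good_iff.2 ⟨hD, fun k => ⟨fun hk => absurd hk (not_or.2 (hm' k)),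
      fun hk => absurd hk (hm' m).1⟩⟩⟩
  · push Not at h
    have hfield : ∀ m, D m = false → m ∈ codedField x := fun m hm => by
      by_contra hcon
      exact h m hcon hm
    obtain ⟨c, hc, hle⟩ := hx.least {m | D m = false} hfield ⟨n, hn⟩
    refine ⟨c, good_iff.2 ⟨hc, fun m => ⟨fun hm => ?_, fun _ _ hm => ⟨hle m hm, fun hne hmc => ?_⟩⟩⟩⟩
    · rcases hm with hm | hm
      · exact ⟨hx.refl _ ⟨m, Or.inl hm⟩, hx.refl _ ⟨c, Or.inr hm⟩⟩
      · exact ⟨hx.refl _ ⟨m, Or.inr hm⟩, hx.refl _ ⟨c, Or.inl hm⟩⟩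
    · exact hne (hx.antisymm m c hmc (hle m hm))

end Counting

end ITTM

/-! ### The whole computation -/

namespace ITTM

namespace Counting

theorem rowsAt_limit {x : CantorReal} {l : Ordinal.{0}} (hl : Order.IsSuccLimit l) (j : ℕ) (t : Tape)
    (k : Track) :
    rowsAt x l j t k = true ↔ ∀ b < l, ∃ a < l, b ≤ a ∧ rowsAt x a j t k = true := by
  rw [rowsAt, Program.run_limit _ _ _ hl]
  simp only [Program.limitConfig, decide_eq_true_eq]
  push Not
  simp only [Bool.not_eq_false]
  exact ⟨fun h b hb => by
    obtain ⟨a, ha, hba, h⟩ := h b hb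
    exact ⟨a, ha, hba, h⟩, fun h b hb => by
    obtain ⟨a, ha, hba, h⟩ := h b hb
    exact ⟨a, ha, hba, h⟩⟩

theorem rowsAt_limit_eq {x : CantorReal} {l b : Ordinal.{0}} (hl : Order.IsSuccLimit l) (hb : b < l)
    {j : ℕ} {t : Tape} {k : Track} {v : Bool}
    (h : ∀ a, b ≤ a → a < l → rowsAt x a j t k = v) : rowsAt x l j t k = v := by
  cases v
  · rw [← Bool.not_eq_true, rowsAt_limit hl]
    intro h'
    obtain ⟨a, ha, hba, h1⟩ := h' b hb
    rw [h a hba ha] at h1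
    cases h1
  · rw [rowsAt_limit hl]
    intro b' hb'
    exact ⟨max b b', max_lt hb hb', le_max_right _ _, h _ (le_max_left _ _) (max_lt hb hb')⟩

theorem atLimit_of_isSuccLimit {x : CantorReal} {l : Ordinal.{0}} (hl : Order.IsSuccLimit l) :
    AtLimit x l := by
  refine run_eq_conf ?_ ?_ <;> rw [Program.run_limit _ _ _ hl] <;> rfl

/-- Every stage after the first pass belongs to a segment. -/
theorem exists_segment {b β : Ordinal.{0}} (hb : Ordinal.omega0 ≤ b) (h : b < Ordinal.omega0 * β) :
    ∃ γ, 1 ≤ γ ∧ γ < β ∧ Ordinal.omega0 * γ ≤ b ∧ b < Ordinal.omega0 * γ + Ordinal.omega0 := by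
  obtain ⟨γ, hγ, r, hr, rfl⟩ := Ordinal.lt_mul_iff.1 h
  refine ⟨γ, ?_, hγ, le_self_add, (add_lt_add_iff_left _).2 hr⟩
  rw [Order.one_le_iff_pos]
  rcases eq_or_ne γ 0 with rfl | h0
  · rw [mul_zero, zero_add] at hb
    exact absurd hr (not_lt.2 hb)
  · exact pos_iff_ne_zero.2 h0

/-- The course of the computation up to stage `ω * β`. -/
structure Upto (x : CantorReal) (β : Ordinal.{0}) : Prop where
  inv : Inv x β
  sound : Sound x (deleted x β)
  running : ∀ b, b < Ordinal.omega0 * β → (program.run x b).state ≠ State.halt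
  mono : ∀ γ, 1 ≤ γ → γ ≤ β → ∀ n, deleted x γ n = true → deleted x β n = true

theorem upto_one (x : CantorReal) : Upto x 1 := by
  obtain ⟨h1, h2, h3, h4⟩ := run_omega x
  rw [← mul_one Ordinal.omega0] at h1 h2 h3 h4
  have hD := deleted_eq h3
  refine ⟨⟨h2, by rw [hD]; exact h3, Or.inl h4⟩, ?_, h1, fun γ h5 h6 => ?_⟩
  · rw [hD]
    exact Sound.of_forall_exists fun n hn => by cases hn
  · rw [le_antisymm h6 h5]
    exact fun n hn => hn

theorem Upto.add_one {x : CantorReal} {β : Ordinal.{0}} (h : Upto x β) (hf : ¬ FinalAt x β) :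
    Upto x (β + 1) := by
  obtain ⟨hs, hi, hD, -, -⟩ := h.inv.next hf
  have hmul : Ordinal.omega0 * (β + 1) = Ordinal.omega0 * β + Ordinal.omega0 := mul_add_one _ _
  refine ⟨hi, ?_, fun b hb => ?_, fun γ h1 h2 n hn => ?_⟩
  · rcases hD with hD | ⟨c, hc, hD⟩
    · rw [hD]; exact h.sound
    · rw [hD]; exact h.sound.insert hc
  · rcases lt_or_ge b (Ordinal.omega0 * β) with hb' | hb'
    · exact h.running b hb'
    · exact (hs.between b hb' (by rwa [← hmul])).1
  · rcases h2.lt_or_eq with h2 | rfl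
    · obtain ⟨-, E, -, h3, h4⟩ := hs.between _ le_rfl
        ((lt_add_iff_pos_right _).2 Ordinal.omega0_pos)
      exact h4 n (h3 n (h.mono γ h1 (Order.lt_add_one_iff.1 h2) n hn))
    · exact hn

theorem upto_limit {x : CantorReal} {β : Ordinal.{0}} (hβ : Order.IsSuccLimit β)
    (h : ∀ γ, 1 ≤ γ → γ < β → Upto x γ) (hf : ∀ γ, 1 ≤ γ → γ < β → ¬ FinalAt x γ) : Upto x β := by
  have hl : Order.IsSuccLimit (Ordinal.omega0 * β) :=
    Ordinal.isSuccLimit_mul_right Ordinal.omega0_pos hβ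
  have hlt : ∀ γ, γ < β → Ordinal.omega0 * γ < Ordinal.omega0 * β := fun γ hγ =>
    (mul_lt_mul_iff_right₀ Ordinal.omega0_pos).2 hγ
  have h1 : 1 < β := by
    have := hβ.succ_lt hβ.bot_lt
    simpa using this
  have hω : Ordinal.omega0 < Ordinal.omega0 * β := by simpa using hlt 1 h1
  have hadd : ∀ γ, γ < β → γ + 1 < β := fun γ hγ => by
    have := hβ.succ_lt hγ
    rwa [Order.succ_eq_add_one] at this
  have hseg : ∀ b, Ordinal.omega0 ≤ b → b < Ordinal.omega0 * β →
      (program.run x b).state ≠ State.halt ∧ ∃ E : ℕ → Bool, Page x (diagonal x) E (rowsAt x b) ∧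
        ∃ γ, 1 ≤ γ ∧ γ < β ∧ Ordinal.omega0 * γ ≤ b ∧ b < Ordinal.omega0 * (γ + 1) ∧
          (∀ n, deleted x γ n = true → E n = true) ∧
          ∀ n, E n = true → deleted x (γ + 1) n = true := by
    intro b hb hb'
    obtain ⟨γ, h2, h3, h4, h5⟩ := exists_segment hb hb'
    obtain ⟨h6, E, h7, h8, h9⟩ := ((h γ h2 h3).inv.next (hf γ h2 h3)).1.between b h4 h5
    exact ⟨h6, E, h7, γ, h2, h3, h4, by rwa [mul_add_one], h8, h9⟩
  have hmono : ∀ γ, 1 ≤ γ → γ < β → ∀ n, deleted x γ n = true → deleted x β n = true := by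
    intro γ h2 h3 n hn
    refine rowsAt_limit_eq hl (hlt γ h3) fun b hb hb' => ?_
    have hb1 : Ordinal.omega0 ≤ b := le_trans (by
      simpa using (mul_le_mul_iff_right₀ Ordinal.omega0_pos).2 h2) hb
    obtain ⟨-, E, hE, δ, h4, h5, h6, h7, h8, -⟩ := hseg b hb1 hb'
    have h9 : γ ≤ δ := Order.lt_add_one_iff.1
      ((mul_lt_mul_iff_right₀ Ordinal.omega0_pos).1 (lt_of_le_of_lt hb h7))
    rw [hE.sheet.del]
    exact h8 n ((h δ h4 h5).mono γ h2 h9 n hn)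
  refine ⟨⟨atLimit_of_isSuccLimit hl, ⟨⟨fun j k => ?_, fun j k => ?_, fun j => ?_, fun j => ?_,
    fun j => rfl⟩, ?_⟩, Or.inl ?_⟩, ?_, fun b hb => ?_, fun γ h2 h3 => ?_⟩
  · exact rowsAt_limit_eq hl hω fun b hb hb' => by
      obtain ⟨-, E, hE, -⟩ := hseg b hb hb'; exact hE.sheet.input j k
  · exact rowsAt_limit_eq hl hω fun b hb hb' => by
      obtain ⟨-, E, hE, -⟩ := hseg b hb hb'; exact hE.sheet.output j k
  · exact rowsAt_limit_eq hl hω fun b hb hb' => by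
      obtain ⟨-, E, hE, -⟩ := hseg b hb hb'; exact hE.sheet.home j
  · exact rowsAt_limit_eq hl hω fun b hb hb' => by
      obtain ⟨-, E, hE, -⟩ := hseg b hb hb'; exact hE.sheet.diag j
  · exact rowsAt_limit_eq hl hω fun b hb hb' => by
      obtain ⟨-, E, hE, -⟩ := hseg b hb hb'; exact hE.home
  · -- a deletion, during which the flag `fresh` is set, follows every stage
    rw [rowsAt_limit hl]
    intro b hb
    have key : ∀ γ, 1 ≤ γ → γ < β → ∃ a < Ordinal.omega0 * β, Ordinal.omega0 * (γ + 1) ≤ a ∧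
        rowsAt x a 0 .scratch .fresh = true := by
      intro γ h2 h3
      have h4 : 1 ≤ γ + 1 := le_trans h2 le_self_add
      obtain ⟨-, -, -, h5, -⟩ := (h γ h2 h3).inv.next (hf γ h2 h3)
      obtain ⟨c, hc⟩ := h5.resolve_right (hf _ h4 (hadd γ h3))
      obtain ⟨-, -, -, -, h6⟩ := (h _ h4 (hadd γ h3)).inv.next (hf _ h4 (hadd γ h3))
      obtain ⟨⟨a, h7, h8, h9⟩, -⟩ := h6 c hc
      exact ⟨a, h8.trans (hlt _ (hadd _ (hadd γ h3))), h7, h9⟩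
    rcases le_total Ordinal.omega0 b with hb' | hb'
    · obtain ⟨-, E, -, γ, h2, h3, -, h5, -⟩ := hseg b hb' hb
      obtain ⟨a, h6, h7, h8⟩ := key γ h2 h3
      exact ⟨a, h6, h5.le.trans h7, h8⟩
    · obtain ⟨a, h6, h7, h8⟩ := key 1 le_rfl h1
      refine ⟨a, h6, hb'.trans (le_trans ?_ h7), h8⟩
      simp
  · refine Sound.of_forall_exists fun n hn => ?_
    by_contra hcon
    push Not at hcon
    have : deleted x β n = false := by
      refine rowsAt_limit_eq hl hω fun b hb hb' => ?_
      obtain ⟨-, E, hE, γ, h2, h3, -, -, -, h9⟩ := hseg b hb hb'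
      rw [hE.sheet.del, ← Bool.not_eq_true]
      intro hEn
      exact hcon _ (h (γ + 1) (le_trans h2 le_self_add) (hadd γ h3)).sound (h9 n hEn)
    rw [this] at hn
    cases hn
  · rcases lt_or_ge b Ordinal.omega0 with hb' | hb'
    · exact (run_omega x).1 b hb'
    · exact (hseg b hb' hb).1
  · rcases h3.lt_or_eq with h3 | rfl
    · exact hmono γ h2 h3
    · exact fun n hn => hn

theorem upto (x : CantorReal) (β : Ordinal.{0}) (h1 : 1 ≤ β)
    (hf : ∀ γ, 1 ≤ γ → γ < β → ¬ FinalAt x γ) : Upto x β := by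
  induction β using Ordinal.limitRecOn with
  | zero => exact absurd h1 (by simp)
  | add_one β ih =>
    rcases eq_or_ne β 0 with rfl | h0
    · rw [zero_add]; exact upto_one x
    · have h2 : 1 ≤ β := Order.one_le_iff_pos.2 (pos_iff_ne_zero.2 h0)
      have h3 : β < β + 1 := Order.lt_add_one_iff.2 le_rfl
      exact (ih h2 fun γ h4 h5 => hf γ h4 (h5.trans h3)).add_one (hf β h2 h3)
  | limit β hβ ih =>
    exact upto_limit hβ (fun γ h2 h3 => ih γ h3 h2 fun δ h4 h5 => hf δ h4 (h5.trans h3)) hf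

/-- The search fails at some stage, since otherwise the deleted numbers would be different for all
ordinals. -/
theorem exists_finalAt (x : CantorReal) : ∃ β, 1 ≤ β ∧ FinalAt x β := by
  by_contra hcon
  push Not at hcon
  have hup : ∀ β, 1 ≤ β → Upto x β := fun β h1 => upto x β h1 fun γ h2 _ => hcon γ h2
  have hpos : ∀ β : Ordinal.{0}, 1 ≤ β + 1 := fun β => le_add_self
  have hex : ∀ β : Ordinal.{0}, ∃ c, deleted x (β + 1 + 1) c = false ∧
      deleted x (β + 1 + 1 + 1) c = true := by
    intro β
    obtain ⟨-, -, -, h1, -⟩ := (hup _ (hpos β)).inv.next (hcon _ (hpos β))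
    obtain ⟨c, hc⟩ := h1.resolve_right (hcon _ (hpos _))
    obtain ⟨-, -, -, -, h2⟩ := (hup _ (hpos (β + 1))).inv.next (hcon _ (hpos _))
    exact ⟨c, (good_iff.1 hc.2.2.1).1, (h2 c hc).2⟩
  choose f hf hf' using hex
  have hne : ∀ β γ, β < γ → f β ≠ f γ := by
    intro β γ h heq
    have h1 := (hup _ (hpos (γ + 1))).mono (β + 1 + 1 + 1) (hpos _) (by
      rw [Order.add_one_le_iff]
      simpa using h) _ (hf' β)
    rw [heq, hf γ] at h1
    cases h1
  exact not_injective_of_ordinal f fun β γ heq => by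
    rcases lt_trichotomy β γ with h | h | h
    exacts [absurd heq (hne β γ h), h, absurd heq.symm (hne γ β h)]

theorem mem_WO_iff_of_finalAt {x : CantorReal} {β : Ordinal.{0}} (hs : Sound x (deleted x β))
    (hf : FinalAt x β) :
    rowsAt x (Ordinal.omega0 * β) 0 .scratch .left = false ↔ x ∈ WO := by
  obtain ⟨-, -, h1, h2⟩ := hf
  constructor
  · intro h
    refine codesWellOrder_of_sound hs fun n => ?_
    by_contra hn
    rw [h2.2 ⟨n, by simpa using hn⟩] at h
    cases h
  · intro hx
    rw [← Bool.not_eq_true, h2]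
    rintro ⟨n, hn⟩
    obtain ⟨c, hc⟩ := exists_good hx hn
    exact h1 c hc

open Classical in
/-- The machine halts with the right answer. -/
theorem exists_halt (x : CantorReal) : ∃ a, (program.run x a).state = State.halt ∧
    (∀ b, b < a → (program.run x b).state ≠ State.halt) ∧
    (program.run x a).cells .output = if x ∈ WO then CantorReal.one else CantorReal.zero := by
  obtain ⟨β, ⟨h1, hfin⟩, hmin⟩ := WellFounded.has_min (r := (· < · : Ordinal.{0} → _ → Prop))
    wellFounded_lt {β | 1 ≤ β ∧ FinalAt x β} (exists_finalAt x)
  have hup := upto x β h1 fun γ h2 h3 h4 => hmin γ ⟨h2, h4⟩ h3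
  set R := rowsAt x (Ordinal.omega0 * β) with hR
  have hstep : machine.step ⟨.limit, 0, R⟩ = ⟨.halt, 0, Function.update R 0 (answer (R 0))⟩ := by
    simp [BlockMachine.step, machine, hR, hfin.1, hfin.2.1, Move.act]
  have hp := machine.path_step place two_le_width ⟨.limit, 0, R⟩ nofun
  rw [hstep] at hp
  obtain ⟨k, hk, hbet⟩ := Program.run_of_path hup.inv.atLimit hp
  refine ⟨Ordinal.omega0 * β + k, by rw [hk]; rfl, fun b hb => ?_, ?_⟩
  · rcases lt_or_ge b (Ordinal.omega0 * β) with h | h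
    · exact hup.running b h
    · exact (hbet b h hb).1
  · rw [hk]
    have hleft := mem_WO_iff_of_finalAt hup.sound hfin
    rw [← hR] at hleft
    have hval : (!R 0 .scratch .left) = decide (x ∈ WO) := by
      rw [Bool.eq_iff_iff, Bool.not_eq_true', hleft, decide_eq_true_iff]
    funext n
    obtain ⟨j, κ, rfl⟩ := BlockMachine.exists_row_eq place n
    refine (BlockMachine.flatten_row place (Function.update R 0 (answer (R 0))) .output j κ).trans ?_
    have hout := hup.inv.page.sheet.output
    rw [← hR] at hout
    have hanswer : Function.update R 0 (answer (R 0)) j .output κ =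
        (decide (x ∈ WO) && decide (j * width + (place κ : ℕ) = 0)) := by
      rcases eq_or_ne j 0 with rfl | hj
      · rw [Function.update_self]
        simp only [answer]
        rcases eq_or_ne κ (place.symm 0) with rfl | hκ
        · rw [Function.update_self, hval]
          simp
        · rw [Function.update_of_ne hκ, hout]
          have : (place κ : ℕ) ≠ 0 := fun h => hκ ((Equiv.eq_symm_apply _).2 (Fin.ext h))
          simp [this]
      · rw [Function.update_of_ne hj, hout]
        have : width ≠ 0 := NeZero.ne _
        simp [hj, this]
    rw [hanswer]
    split_ifs with hx <;> simp [hx, CantorReal.one, CantorReal.zero]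

end Counting

end ITTM

theorem mainTheorem2 : ITTM.IsDecidable WO := by
  classical
  refine ⟨ITTM.Counting.program, ?_⟩
  refine PFun.ext fun x y => ?_
  obtain ⟨a, ha, hmin, hout⟩ := ITTM.Counting.exists_halt x
  have hinf : sInf (ITTM.Counting.program.haltStages x) = a :=
    le_antisymm (csInf_le' ha) (le_csInf ⟨a, ha⟩ fun b hb => not_lt.1 fun h => hmin b h hb)
  rw [PFun.coe_val, Part.mem_some_iff]
  constructor
  · rintro ⟨-, rfl⟩
    change (ITTM.Counting.program.run x (sInf _)).cells _ = _
    rw [hinf, hout]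
  · rintro rfl
    refine ⟨⟨a, ha⟩, ?_⟩
    change (ITTM.Counting.program.run x (sInf _)).cells _ = _
    rw [hinf, hout]
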